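/- **Setup.** Let $D=\{(x^{(i)},y^{(i)})\}_{i=1}^n$ be a dataset with $x^{(i)}\in\mathbb R^d$, $\|x^{(i)}\|_2\le B_2$, $y^{(i)}\in\mathbb R$. Let $m,k\ge 1$ be integers with $mk\le n$, let $\emptyset\ne N\subseteq[n]$ and $\rho=|N|/n$. The mechanism noisy-wtd-LLP works as follows. * It draws i.i.d. $g_i\sim N(0,1)$ and forms the intermediate dataset $\tilde D=\{(x^{(i)},\tilde y^{(i)})\}_{i=1}^n$, where $\tilde y^{(i)}=y^{(i)}+g_i$ for $i\in N$ and $\tilde y^{(i)}=y^{(i)}$ for $i\notin N$. * Independently, it draws $m$ disjoint bags $S_j=\{i_{j1},\dots,i_{jk}\}\subseteq[n]$ of size $k$, uniformly at random without replacement, and i.i.d. weights $w_{jr}\sim N(0,1)$. * Its output $\tilde D_{\rm LLP}$ consists of the bags with their feature vectors and weights, and of the bag labels $\bar y^{(j)}=\sum_{r=1}^k w_{jr}\tilde y^{(i_{jr})}$. For a model $f:\mathbb R^d\to\mathbb R$ put $$\mathrm{val}(\tilde D,f)=\sum_{i=1}^n\bigl(\tilde y^{(i)}-f(x^{(i)})\bigr)^2,\qquad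 \mathrm{val}(\tilde D_{\rm LLP},f)=\sum_{j=1}^m\Bigl(\bar y^{(j)}-\sum_{r=1}^k w_{jr}f(x^{(i_{jr})})\Bigr)^2 .$$ Let $\mathcal F_1$ be a class of models $f$, each given by a vector $s_f\in\mathbb R^{d'}$ of $d'\ge1$ parameters, such that $\|s_f\|_2\le B_4$ for all $f\in\mathcal F_1$ and $|f(x)-f'(x)|\le L\|s_f-s_{f'}\|_2$ for all $f,f'\in\mathcal F_1$ and all $\|x\|_2\le B_2$ (for example, bounded neural networks). Here $L,B_4\ge0$. Let $B_{\rm loss}>0$ satisfy $(y^{(i)}-f(x^{(i)}))^2\le B_{\rm loss}$ for all $f\in\mathcal F_1$ and all $i$. **Statement.** There are absolute constants $c_1,c_2,c_3,c_4,C_1,C_2>0$ such that, in every such situation and for every $\theta>0$, $$\Bigl|\tfrac1{mk}\mathrm{val}(\tilde D_{\rm LLP},f)-\tfrac1n\mathrm{val}(\tilde D,f)\Bigr|\le\theta\quad\text{for all } f\in\mathcal F_1$$ except with probability at most $$\exp\Bigl(-\min\Bigl\{\tfrac{c_1m\theta^2}{B_{\rm loss}^2},\ \tfrac{c_2mk\theta^2}{\rho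 B_{\rm loss}},\ c_3m^{1/4}-C_1\log k,\ \tfrac{c_4\theta^2\sqrt m}{k^2+kB_{\rm loss}}\Bigr\}+C_2\,d'\max\Bigl\{1,\log\tfrac{mLB_4B_{\rm loss}}{\theta}\Bigr\}\Bigr),$$ where $\max\{1,\log t\}$ is $1$ for $t=0$. Moreover, outside the same exceptional event, every minimizer $f^*$ of $\mathrm{val}(\tilde D_{\rm LLP},\cdot)$ over $\mathcal F_1$ satisfies $\tfrac1n\mathrm{val}(\tilde D,f^*)\le\tfrac1n\mathrm{val}(\tilde D,f)+2\theta$ for all $f\in\mathcal F_1$. -/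

import Mathlib

open MeasureTheory ProbabilityTheory

noncomputable section

namespace NoisyWtdLLP

/-- A dataset of `n` labelled examples with feature vectors in `ℝ^d`. -/
structure Dataset (n d : ℕ) where
  /-- the feature vectors -/
  x : Fin n → EuclideanSpace ℝ (Fin d)
  /-- the labels -/
  y : Fin n → ℝ

/-- The squared loss `val(D, f) = ∑ i, (y i - f (x i))²` of a model on a labelled dataset. -/
def Dataset.val {n d : ℕ} (D : Dataset n d) (f : EuclideanSpace ℝ (Fin d) → ℝ) : ℝ :=
  ∑ i, (D.y i - f (D.x i)) ^ 2

/-- A weighted dataset for learning from label proportions: `m` bags of size `k`, with the indices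
and the feature vectors of the members of each bag, the weights of the members, and one aggregated
label per bag. -/
structure LLPDataset (n d m k : ℕ) where
  /-- index of the `r`-th member of bag `j` -/
  idx : Fin m → Fin k → Fin n
  /-- feature vector of the `r`-th member of bag `j` -/
  x : Fin m → Fin k → EuclideanSpace ℝ (Fin d)
  /-- aggregation weight of the `r`-th member of bag `j` -/
  w : Fin m → Fin k → ℝ
  /-- aggregated label of bag `j` -/
  label : Fin m → ℝ

/-- The squared loss of a model on an LLP dataset: the sum over the bags of the squared difference
of the bag label and the weighted sum of the predictions on the members of the bag. -/
def LLPDataset.val {n d m k : ℕ} (D : LLPDataset n d m k) (f : EuclideanSpace ℝ (Fin d) → ℝ) : ℝ :=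
  ∑ j, (D.label j - ∑ r, D.w j r * f (D.x j r)) ^ 2

/-- A choice of `m` pairwise disjoint bags of `k` distinct indices in `[n]`, each bag being listed
in some order: the index `i_{jr}` is the image of `(j, r)`. -/
abbrev Bags (m k n : ℕ) : Type := (Fin m × Fin k) ↪ Fin n

instance instMeasurableSpaceBags (m k n : ℕ) : MeasurableSpace (Bags m k n) := ⊤

/-- The randomness of the mechanism: the bags, the weights `w_{jr}`, and the label noise `g_i`. -/
abbrev Randomness (m k n : ℕ) : Type := Bags m k n × (Fin m × Fin k → ℝ) × (Fin n → ℝ)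

/-- The law of the randomness: the bags are drawn uniformly without replacement, the weights and the
noise are i.i.d. standard Gaussians, and these three are independent. -/
def law (m k n : ℕ) : Measure (Randomness m k n) :=
  (uniformOn (Set.univ : Set (Bags m k n))).prod
    ((Measure.pi fun _ : Fin m × Fin k => gaussianReal 0 1).prod
      (Measure.pi fun _ : Fin n => gaussianReal 0 1))

/-- The law is a probability measure as soon as `m` disjoint bags of size `k` fit into `[n]`. -/
theorem isProbabilityMeasure_law {m k n : ℕ} (h : m * k ≤ n) :
    IsProbabilityMeasure (law m k n) := by
  have hne : Nonempty (Bags m k n) :=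
    Function.Embedding.nonempty_of_card_le (by simpa using h)
  have : IsProbabilityMeasure (uniformOn (Set.univ : Set (Bags m k n))) :=
    isProbabilityMeasure_uniformOn Set.finite_univ Set.univ_nonempty
  unfold law
  infer_instance

/-- The intermediate dataset: the standard Gaussian `g i` is added to the label `y i` exactly when
`i ∈ N`. -/
def intermediate {n d m k : ℕ} (D : Dataset n d) (N : Finset (Fin n)) (ω : Randomness m k n) :
    Dataset n d where
  x := D.x
  y i := if i ∈ N then D.y i + ω.2.2 i else D.y i

/-- The output of the mechanism: in every bag the noisy labels are summed up with the weights. -/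
def output {n d m k : ℕ} (D : Dataset n d) (N : Finset (Fin n)) (ω : Randomness m k n) :
    LLPDataset n d m k where
  idx j r := ω.1 (j, r)
  x j r := D.x (ω.1 (j, r))
  w j r := ω.2.1 (j, r)
  label j := ∑ r, ω.2.1 (j, r) * (intermediate D N ω).y (ω.1 (j, r))

/-- A class of real-valued models on `ℝ^d` with `d'` parameters: the models `eval s`, where `s`
ranges over a set of admissible parameter vectors. -/
structure ModelClass (d d' : ℕ) where
  /-- the admissible parameter vectors -/
  params : Set (EuclideanSpace ℝ (Fin d'))
  /-- the model with a given parameter vector -/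
  eval : EuclideanSpace ℝ (Fin d') → EuclideanSpace ℝ (Fin d) → ℝ

/-- All parameter vectors have norm at most `B₄`, and at every input of norm at most `B₂` the value
of the model is `L`-Lipschitz in the parameters. -/
def ModelClass.IsBoundedLipschitz {d d' : ℕ} (F : ModelClass d d') (L B₂ B₄ : ℝ) : Prop :=
  (∀ s ∈ F.params, ‖s‖ ≤ B₄) ∧
    ∀ s ∈ F.params, ∀ s' ∈ F.params, ∀ x : EuclideanSpace ℝ (Fin d), ‖x‖ ≤ B₂ →
      |F.eval s x - F.eval s' x| ≤ L * ‖s - s'‖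

end NoisyWtdLLP

end

/-!
# Generalization for label aggregation with random weights and label noise

Let `a s` be the vector of residuals `y i - f_s (x i)` of the model with parameter `s`, and let `η` be
the noise vector, `g i` on `N` and `0` elsewhere. Both losses are quadratic forms in `a s + η`, so the
difference of the normalized losses is `dev (a s) (a s) + 2 dev (a s) η + dev η η` for a symmetric
bilinear form `dev` that depends only on the bags and the weights
(`output_val_sub_intermediate_val`). The statement about minimizers follows from the uniform deviation
bound by comparing the two models (`minimizer_of_uniform_deviation`), so everything rests on a uniform
bound for this form.

*Fixed vectors.* `dev` splits into a part due to the weights and a part due to the choice of the bags.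
Given the bags and the noise, the first is a sum of `m` independent centred products of Gaussians; by
polarization these are differences of squares of Gaussians, and a Bernstein bound applies
(`measure_abs_bilinear_ge_le`). For the second, Hoeffding's inequality for sampling without
replacement holds (`uniformOn_bags_abs_sum_ge_le`), and once the bags are fixed, the contribution of
the noise is a linear or quadratic form in a Gaussian vector. The bounds for vectors involving `η`
hold on the event `goodEvent` that no bag carries much noise and that the bags contain few noisy
indices; at level `r = m ^ (1 / 4)` its complement has probability at most
`2 m exp (-r / 2) + exp (-r / 8)` (`law_goodEvent_compl_le`). The outcome is `law_dev_ge_le`, `law_dev_noise_ge_le` and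
`law_dev_noise_noise_ge_le`.

*All models at once.* A union bound over a single net would leave the error of rounding to the net,
which costs factors polynomial in `m` and `k` inside the logarithm. Instead the parameters are chained
through nets at the scales `σ / 4 ^ l`, where `σ ^ 2 = B` bounds the squared residuals
(`exists_chain`). At level `l` the vectors have size of order `σ / 4 ^ l`, while a deviation of
`θ / 2 ^ l` is allowed; this multiplies the exponential rate by `2 ^ l`, which beats the growth
`4 ^ (2 d' l)` of the number of pairs as soon as the rate at level `0` exceeds a multiple of `d'`
(`law_chain_le`). The total is then of the order of the coarsest level,
`(1 + 2 L B₄ / σ) ^ (2 d') exp (-c E)` with `E = chainRate`.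

*Comparison with the stated bound.* The bound is trivial unless the minimum of the rates exceeds the
dimension term, which supplies the condition on the rate and `r θ ≥ 1`. The logarithm of
`1 + 2 L B₄ / σ` can exceed `max 1 (log (m L B₄ B / θ))` only by about `log (θ / (m σ ^ 3))`
(`log_net_le`), and if this excess is positive then `θ / σ` and `θ / σ ^ 2` are so large that `E`
absorbs it (`log_excess_le`, `min_le_chainRate`).
-/

/-! ### Sums of independent Gaussians and the chi-square moment generating function -/

/-- A finite sum of independent centred Gaussians is Gaussian, and the variances add up. -/
lemma map_sum_gaussianReal_of_iIndepFun {Ω ι : Type*} [MeasurableSpace Ω] {P : Measure Ω}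
    {X : ι → Ω → ℝ} {v : ι → NNReal} (hX : iIndepFun X P) (hmeas : ∀ i, Measurable (X i))
    (hlaw : ∀ i, P.map (X i) = gaussianReal 0 (v i)) (s : Finset ι) :
    P.map (∑ i ∈ s, X i) = gaussianReal 0 (∑ i ∈ s, v i) := by
  classical
  have := hX.isProbabilityMeasure
  induction s using Finset.induction_on with
  | empty =>
    simp only [Finset.sum_empty, gaussianReal_zero_var]
    change P.map (fun _ => (0 : ℝ)) = _
    simp [Measure.map_const]
  | insert i s hi ih =>
    rw [Finset.sum_insert hi, Finset.sum_insert hi]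
    have h := (hX.indepFun_finsetSum_of_notMem hmeas hi).symm
    have := gaussianReal_add_gaussianReal_of_indepFun h (hlaw i) ih
    simpa using this

/-- A linear functional of a standard Gaussian vector is a centred Gaussian. -/
lemma map_linear_pi_gaussianReal {ι : Type*} [Fintype ι] (c : ι → ℝ) :
    (Measure.pi fun _ : ι => gaussianReal 0 1).map (fun w => ∑ i, w i * c i)
      = gaussianReal 0 (∑ i, (c i ^ 2).toNNReal) := by
  have hind : iIndepFun (fun (i : ι) (w : ι → ℝ) => w i * c i)
      (Measure.pi fun _ : ι => gaussianReal 0 1) :=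
    iIndepFun_pi (X := fun i x => x * c i) (fun i => by fun_prop)
  have h := map_sum_gaussianReal_of_iIndepFun (v := fun i => (c i ^ 2).toNNReal) hind
    (fun i => by fun_prop) (fun i => ?_) Finset.univ
  · rw [← h]
    congr 1
    ext w
    simp
  · have : (fun w : ι → ℝ => w i * c i) = (fun x => x * c i) ∘ (fun w => w i) := rfl
    rw [this, ← Measure.map_map (by fun_prop) (by fun_prop),
      (measurePreserving_eval (fun _ : ι => gaussianReal 0 1) i).map_eq, gaussianReal_map_mul_const]
    congr 1
    · simp
    · ext
      simp [sq_nonneg]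

/-- The moment generating function of the square of a standard Gaussian. -/
lemma integral_exp_mul_sq_gaussianReal (t : ℝ) (ht : t < 1 / 2) :
    Integrable (fun x => Real.exp (t * x ^ 2)) (gaussianReal 0 1) ∧
      ∫ x, Real.exp (t * x ^ 2) ∂(gaussianReal 0 1) = (√(1 - 2 * t))⁻¹ := by
  have hpos : 0 < 1 / 2 - t := by linarith
  have key : ∀ x : ℝ, gaussianPDFReal 0 1 x * Real.exp (t * x ^ 2)
      = (√(2 * Real.pi))⁻¹ * Real.exp (-(1 / 2 - t) * x ^ 2) := by
    intro x
    simp only [gaussianPDFReal, NNReal.coe_one, mul_one, sub_zero]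
    rw [mul_assoc, ← Real.exp_add]
    congr 2
    ring
  constructor
  · rw [gaussianReal_of_var_ne_zero _ one_ne_zero]
    rw [integrable_withDensity_iff_integrable_smul' (measurable_gaussianPDF 0 1)
      (ae_of_all _ fun x => gaussianPDF_lt_top)]
    have : (fun x : ℝ => (gaussianPDF 0 1 x).toReal • Real.exp (t * x ^ 2))
        = fun x => (√(2 * Real.pi))⁻¹ * Real.exp (-(1 / 2 - t) * x ^ 2) := by
      ext x
      rw [toReal_gaussianPDF, smul_eq_mul, key]
    rw [this]
    exact (integrable_exp_neg_mul_sq hpos).const_mul _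
  · rw [integral_gaussianReal_eq_integral_smul one_ne_zero]
    simp only [smul_eq_mul, key]
    rw [integral_const_mul, integral_gaussian, ← Real.sqrt_inv, ← Real.sqrt_inv, ← Real.sqrt_mul (by positivity)]
    congr 1
    have := Real.pi_ne_zero
    have h2 : 1 - 2 * t ≠ 0 := by linarith
    field_simp

/-- The centred square of a standard Gaussian is sub-exponential: the left-hand side is its moment
generating function. -/
lemma inv_sqrt_mul_exp_neg_le (t : ℝ) (h : |t| ≤ 1 / 4) :
    (√(1 - 2 * t))⁻¹ * Real.exp (-t) ≤ Real.exp (2 * t ^ 2) := by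
  obtain ⟨h1, h2⟩ := abs_le.1 h
  have hpos : 0 < 1 - 2 * t := by linarith
  -- `(1 - x) exp (x + x²) ≥ 1` for `x = 2 t`
  have key : 1 ≤ (1 - 2 * t) * Real.exp (2 * t + 4 * t ^ 2) := by
    rcases le_total t 0 with h0 | h0
    · have := Real.add_one_le_exp (2 * t + 4 * t ^ 2)
      nlinarith [mul_le_mul_of_nonneg_left this hpos.le, mul_nonneg (neg_nonneg.2 h0) (sq_nonneg t)]
    · have := Real.quadratic_le_exp_of_nonneg (x := 2 * t + 4 * t ^ 2) (by positivity)
      have h3 := mul_le_mul_of_nonneg_left this hpos.le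
      have h4 : 0 ≤ t ^ 2 * ((1 - (2 * t) ^ 2) * (1 + 2 * t) - 4 * t) := by
        apply mul_nonneg (sq_nonneg t)
        nlinarith [mul_nonneg h0 h0]
      nlinarith
  have hs : 1 ≤ √(1 - 2 * t) * Real.exp (t + 2 * t ^ 2) := by
    have : √(1 - 2 * t) * Real.exp (t + 2 * t ^ 2)
        = √((1 - 2 * t) * Real.exp (2 * t + 4 * t ^ 2)) := by
      rw [Real.sqrt_mul hpos.le, ← Real.exp_half]
      congr 2
      ring
    rw [this]
    exact Real.one_le_sqrt.2 key
  rw [inv_mul_le_iff₀ (Real.sqrt_pos.2 hpos)]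
  have : Real.exp (2 * t ^ 2) = Real.exp (t + 2 * t ^ 2) * Real.exp (-t) := by
    rw [← Real.exp_add]; congr 1; ring
  rw [this, ← mul_assoc]
  exact le_mul_of_one_le_left (Real.exp_pos _).le hs

/-- A centred square of a Gaussian of variance `v`, scaled by `c`, is sub-exponential with
parameter `M ≥ |c| v`. -/
lemma mgf_sq_sub_gaussianReal_le {Ω : Type*} [MeasurableSpace Ω] {P : Measure Ω} {X : Ω → ℝ}
    (hX : Measurable X) {v : NNReal} (hlaw : P.map X = gaussianReal 0 v) {c M : ℝ}
    (hM : |c| * v ≤ M) {t : ℝ} (ht : |t| * M ≤ 1 / 4) :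
    Integrable (fun ω => Real.exp (t * (c * (X ω ^ 2 - v)))) P ∧
      mgf (fun ω => c * (X ω ^ 2 - v)) P t ≤ Real.exp (2 * t ^ 2 * M ^ 2) := by
  have hv : (gaussianReal 0 1).map (fun x => √v * x) = gaussianReal 0 v := by
    rw [gaussianReal_map_const_mul]
    congr 1
    · simp
    · ext; simp
  have htc : |t * c * v| ≤ |t| * M := by
    rw [mul_assoc, abs_mul, abs_mul, abs_of_nonneg v.coe_nonneg]
    exact mul_le_mul_of_nonneg_left hM (abs_nonneg _)
  have habs := htc.trans ht
  have hlt : t * c * v < 1 / 2 := by linarith [le_abs_self (t * c * v)]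
  have hfun : ∀ x : ℝ, Real.exp (t * (c * ((√v * x) ^ 2 - v)))
      = Real.exp (t * c * v * x ^ 2) * Real.exp (-(t * c * v)) := by
    intro x
    rw [mul_pow, Real.sq_sqrt v.coe_nonneg, ← Real.exp_add]
    congr 1; ring
  obtain ⟨hint, hval⟩ := integral_exp_mul_sq_gaussianReal (t * c * v) hlt
  have hmeas : AEStronglyMeasurable (fun x : ℝ => Real.exp (t * (c * (x ^ 2 - v)))) (P.map X) := by
    fun_prop
  constructor
  · have h1 : Integrable (fun x : ℝ => Real.exp (t * (c * (x ^ 2 - v)))) (P.map X) := by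
      rw [hlaw, ← hv, integrable_map_measure (by fun_prop) (by fun_prop)]
      simp only [Function.comp_def, hfun]
      exact hint.mul_const _
    exact h1.comp_measurable hX
  · have : mgf (fun ω => c * (X ω ^ 2 - v)) P t
        = ∫ x, Real.exp (t * (c * (x ^ 2 - v))) ∂(P.map X) := by
      rw [integral_map hX.aemeasurable hmeas]; rfl
    rw [this, hlaw, ← hv, integral_map (by fun_prop) (by fun_prop)]
    simp only [hfun]
    rw [integral_mul_const, hval]
    refine (inv_sqrt_mul_exp_neg_le _ habs).trans (Real.exp_le_exp.2 ?_)
    have : (t * c * v) ^ 2 ≤ (t * M) ^ 2 := by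
      rw [sq_le_sq, abs_mul t M]
      exact htc.trans (mul_le_mul_of_nonneg_left (le_abs_self M) (abs_nonneg t))
    nlinarith

/-! ### Bernstein-type tail bounds -/

/-- Bernstein's inequality: a sum of at most `K` independent sub-exponential variables with
parameter `M` has a Gaussian tail up to `K M` and an exponential tail beyond. -/
lemma measure_abs_sum_ge_le_of_mgf_le {Ω ι : Type*} [MeasurableSpace Ω] {P : Measure Ω}
    [Fintype ι] {Y : ι → Ω → ℝ} (hY : iIndepFun Y P) (hmeas : ∀ i, Measurable (Y i)) {M K : ℝ}
    (hM : 0 < M) (hK : 0 < K) (hcard : (Fintype.card ι : ℝ) ≤ K)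
    (hmgf : ∀ i t, |t| * M ≤ 1 / 4 →
      Integrable (fun ω => Real.exp (t * Y i ω)) P ∧ mgf (Y i) P t ≤ Real.exp (2 * t ^ 2 * M ^ 2))
    {x : ℝ} (hx : 0 < x) :
    P.real {ω | x ≤ |∑ i, Y i ω|}
      ≤ 2 * Real.exp (-(min (x ^ 2 / (K * M ^ 2)) (x / M) / 8)) := by
  have := hY.isProbabilityMeasure
  -- the Chernoff parameter: the minimizer of the exponent, cut off where the bound on the moment
  -- generating function ends
  set lam : ℝ := min (x / (4 * K * M ^ 2)) (1 / (4 * M)) with hlam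
  have hlam0 : 0 < lam := lt_min (by positivity) (by positivity)
  have hlamM : lam * M ≤ 1 / 4 := by
    calc lam * M ≤ 1 / (4 * M) * M := mul_le_mul_of_nonneg_right (min_le_right _ _) hM.le
      _ = 1 / 4 := by field_simp
  have hprod : ∀ t : ℝ, |t| = lam →
      Integrable (fun ω => Real.exp (t * (∑ i, Y i) ω)) P ∧
        mgf (∑ i, Y i) P t ≤ Real.exp (2 * lam ^ 2 * (K * M ^ 2)) := by
    intro t ht
    have ht' : |t| * M ≤ 1 / 4 := by rw [ht]; exact hlamM
    refine ⟨hY.integrable_exp_mul_sum hmeas (fun i _ => (hmgf i t ht').1), ?_⟩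
    rw [hY.mgf_sum hmeas]
    calc ∏ i, mgf (Y i) P t ≤ ∏ _i : ι, Real.exp (2 * t ^ 2 * M ^ 2) :=
          Finset.prod_le_prod (fun i _ => mgf_nonneg) (fun i _ => (hmgf i t ht').2)
      _ = Real.exp (Fintype.card ι * (2 * t ^ 2 * M ^ 2)) := by
          rw [Finset.prod_const, Finset.card_univ, ← Real.exp_nat_mul]
      _ ≤ _ := by
          apply Real.exp_le_exp.2
          rw [← ht, sq_abs]
          nlinarith [mul_le_mul_of_nonneg_right hcard (show 0 ≤ 2 * t ^ 2 * M ^ 2 by positivity)]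
  -- the choice of `lam` makes the exponent at most minus the stated rate
  have hexp : -lam * x + 2 * lam ^ 2 * (K * M ^ 2)
      ≤ -(min (x ^ 2 / (K * M ^ 2)) (x / M) / 8) := by
    have h1 : lam * (K * M ^ 2) ≤ x / 4 := by
      calc lam * (K * M ^ 2) ≤ x / (4 * K * M ^ 2) * (K * M ^ 2) :=
            mul_le_mul_of_nonneg_right (min_le_left _ _) (by positivity)
        _ = x / 4 := by field_simp
    have h2 : min (x ^ 2 / (K * M ^ 2)) (x / M) / 8 = lam * x / 2 := by
      rw [hlam, min_mul_of_nonneg _ _ hx.le, ← min_div_div_right (by norm_num : (0 : ℝ) ≤ 8),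
        ← min_div_div_right (by norm_num : (0 : ℝ) ≤ 2)]
      congr 1
      · field_simp; norm_num
      · field_simp; norm_num
    rw [h2]
    nlinarith [mul_le_mul_of_nonneg_left h1 hlam0.le]
  have hup : P.real {ω | x ≤ (∑ i, Y i) ω}
      ≤ Real.exp (-(min (x ^ 2 / (K * M ^ 2)) (x / M) / 8)) := by
    obtain ⟨hi, hb⟩ := hprod lam (abs_of_pos hlam0)
    refine (measure_ge_le_exp_mul_mgf x hlam0.le hi).trans ?_
    refine (mul_le_mul_of_nonneg_left hb (Real.exp_pos _).le).trans ?_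
    rw [← Real.exp_add]
    exact Real.exp_le_exp.2 hexp
  have hlow : P.real {ω | (∑ i, Y i) ω ≤ -x}
      ≤ Real.exp (-(min (x ^ 2 / (K * M ^ 2)) (x / M) / 8)) := by
    obtain ⟨hi, hb⟩ := hprod (-lam) (by rw [abs_neg, abs_of_pos hlam0])
    refine (measure_le_le_exp_mul_mgf (-x) (by linarith) hi).trans ?_
    refine (mul_le_mul_of_nonneg_left hb (Real.exp_pos _).le).trans ?_
    rw [← Real.exp_add]
    refine Real.exp_le_exp.2 (le_trans (le_of_eq ?_) hexp)
    ring
  have hsub : {ω | x ≤ |∑ i, Y i ω|} ⊆ {ω | x ≤ (∑ i, Y i) ω} ∪ {ω | (∑ i, Y i) ω ≤ -x} := by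
    intro ω hω
    simp only [Set.mem_ofPred_eq, Set.mem_union, Finset.sum_apply] at hω ⊢
    rcases le_abs.1 hω with h | h
    · exact Or.inl h
    · exact Or.inr (by linarith)
  refine (measureReal_mono hsub).trans ((measureReal_union_le _ _).trans ?_)
  linarith

/-! ### Quadratic, bilinear and linear forms in standard Gaussian vectors -/

/-- The rows of a matrix of i.i.d. standard Gaussians are i.i.d. standard Gaussian vectors. -/
lemma map_curry_pi_gaussianReal (J R : Type*) [Fintype J] [Fintype R] :
    (Measure.pi fun _ : J × R => gaussianReal 0 1).map (fun w j r => w (j, r))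
      = Measure.pi fun _ : J => Measure.pi fun _ : R => gaussianReal 0 1 := by
  have := Measure.infinitePi_map_curry (fun (_ : J) (_ : R) => gaussianReal 0 1)
  simp only [Measure.infinitePi_eq_pi] at this
  exact this

lemma map_row_pi_gaussianReal {J R : Type*} [Fintype J] [Fintype R] (j : J) :
    (Measure.pi fun _ : J × R => gaussianReal 0 1).map (fun w r => w (j, r))
      = Measure.pi fun _ : R => gaussianReal 0 1 := by
  have : (fun (w : J × R → ℝ) r => w (j, r)) = (fun x : J → R → ℝ => x j) ∘ (fun w j r => w (j, r)) :=
    rfl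
  rw [this, ← Measure.map_map (by fun_prop) (by fun_prop), map_curry_pi_gaussianReal,
    (measurePreserving_eval (fun _ : J => Measure.pi fun _ : R => gaussianReal 0 1) j).map_eq]

/-- Functions of distinct rows of a Gaussian matrix are independent. -/
lemma iIndepFun_row_sum {J R : Type*} [Fintype J] [Fintype R] (U : J → R → ℝ) :
    iIndepFun (fun (j : J) (w : J × R → ℝ) => ∑ r, w (j, r) * U j r)
      (Measure.pi fun _ : J × R => gaussianReal 0 1) := by
  rw [iIndepFun_iff_map_fun_eq_pi_map (fun j => Measurable.aemeasurable (by fun_prop))]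
  have h1 : (fun (w : J × R → ℝ) j => ∑ r, w (j, r) * U j r)
      = (fun (x : J → R → ℝ) j => ∑ r, x j r * U j r) ∘ (fun w j r => w (j, r)) := rfl
  have h2 : ∀ j, (fun (w : J × R → ℝ) => ∑ r, w (j, r) * U j r)
      = (fun (x : R → ℝ) => ∑ r, x r * U j r) ∘ (fun w r => w (j, r)) := fun j => rfl
  rw [h1, ← Measure.map_map (by fun_prop) (by fun_prop), map_curry_pi_gaussianReal]
  simp_rw [h2]
  rw [Measure.pi_map_pi (f := fun j (x : R → ℝ) => ∑ r, x r * U j r)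
    (fun j => Measurable.aemeasurable (by fun_prop))]
  congr 1
  ext j : 1
  rw [← Measure.map_map (by fun_prop) (by fun_prop), map_row_pi_gaussianReal]

/-- A block-diagonal quadratic form `∑ j, (∑ r, w j r * U j r)²` in a Gaussian matrix `w`
concentrates around its mean. -/
lemma measure_abs_quadratic_ge_le {J R : Type*} [Fintype J] [Fintype R] (U : J → R → ℝ)
    {M K : ℝ} (hM : 0 < M) (hK : 0 < K) (hcard : (Fintype.card J : ℝ) ≤ K)
    (hU : ∀ j, ∑ r, U j r ^ 2 ≤ M) {x : ℝ} (hx : 0 < x) :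
    (Measure.pi fun _ : J × R => gaussianReal 0 1).real
        {w | x ≤ |∑ j, ((∑ r, w (j, r) * U j r) ^ 2 - ∑ r, U j r ^ 2)|}
      ≤ 2 * Real.exp (-(min (x ^ 2 / (K * M ^ 2)) (x / M) / 8)) := by
  have hind := iIndepFun_row_sum U
  have hind2 := hind.comp (fun j (y : ℝ) => 1 * (y ^ 2 - ∑ r, U j r ^ 2)) (fun j => by fun_prop)
  have := measure_abs_sum_ge_le_of_mgf_le hind2
    (fun j => by simp only [Function.comp_def]; fun_prop) hM hK hcard ?_ hx
  · simpa using this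
  · intro j t ht
    have hlaw : (Measure.pi fun _ : J × R => gaussianReal 0 1).map
        (fun w => ∑ r, w (j, r) * U j r) = gaussianReal 0 (∑ r, (U j r ^ 2).toNNReal) := by
      have h2 : (fun (w : J × R → ℝ) => ∑ r, w (j, r) * U j r)
        = (fun (x : R → ℝ) => ∑ r, x r * U j r) ∘ (fun w r => w (j, r)) := rfl
      rw [h2, ← Measure.map_map (by fun_prop) (by fun_prop), map_row_pi_gaussianReal,
        map_linear_pi_gaussianReal]
    have hv : ((∑ r, (U j r ^ 2).toNNReal : NNReal) : ℝ) = ∑ r, U j r ^ 2 := by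
      simp [sq_nonneg]
    have h := mgf_sq_sub_gaussianReal_le (c := 1) (by fun_prop) hlaw (by rw [hv]; simpa using hU j) ht
    rw [hv] at h
    exact h

/-- A block-diagonal bilinear form `∑ j, (∑ r, w j r * U j r) * (∑ r, w j r * V j r)` in a Gaussian
matrix `w` concentrates around its mean; by polarization this follows from the quadratic case. -/
lemma measure_abs_bilinear_ge_le {J R : Type*} [Fintype J] [Fintype R] (U V : J → R → ℝ)
    {p q K : ℝ} (hp : 0 < p) (hq : 0 < q) (hK : 0 < K) (hcard : (Fintype.card J : ℝ) ≤ K)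
    (hU : ∀ j, ∑ r, U j r ^ 2 ≤ p ^ 2) (hV : ∀ j, ∑ r, V j r ^ 2 ≤ q ^ 2) {x : ℝ} (hx : 0 < x) :
    (Measure.pi fun _ : J × R => gaussianReal 0 1).real
        {w | x ≤ |∑ j, ((∑ r, w (j, r) * U j r) * (∑ r, w (j, r) * V j r) - ∑ r, U j r * V j r)|}
      ≤ 4 * Real.exp (-(min (x ^ 2 / (K * (p * q) ^ 2)) (x / (p * q)) / 32)) := by
  set γ := Measure.pi fun _ : J × R => gaussianReal 0 1
  -- after rescaling, `U` and `V` have rows in the unit ball, so that `U ± V` have rows of norm at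
  -- most `2`
  have hbound : ∀ σ : ℝ, σ ^ 2 = 1 → ∀ j, ∑ r, (U j r / p + σ * (V j r / q)) ^ 2 ≤ 4 := by
    intro σ hσ j
    have h1 : ∑ r, (U j r / p) ^ 2 ≤ 1 := by
      simp_rw [div_pow]
      rw [← Finset.sum_div, div_le_one (by positivity)]
      exact hU j
    have h2 : ∑ r, (V j r / q) ^ 2 ≤ 1 := by
      simp_rw [div_pow]
      rw [← Finset.sum_div, div_le_one (by positivity)]
      exact hV j
    calc ∑ r, (U j r / p + σ * (V j r / q)) ^ 2
        ≤ ∑ r, (2 * (U j r / p) ^ 2 + 2 * (V j r / q) ^ 2) := by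
          refine Finset.sum_le_sum fun r _ => ?_
          nlinarith [sq_nonneg (U j r / p - σ * (V j r / q))]
      _ = 2 * ∑ r, (U j r / p) ^ 2 + 2 * ∑ r, (V j r / q) ^ 2 := by
          rw [Finset.sum_add_distrib, Finset.mul_sum, Finset.mul_sum]
      _ ≤ 4 := by linarith
  have hy : 0 < 2 * x / (p * q) := by positivity
  have hquad := fun σ hσ => measure_abs_quadratic_ge_le
    (fun j r => U j r / p + σ * (V j r / q)) (by norm_num : (0 : ℝ) < 4) hK hcard (hbound σ hσ) hy
  have hpol : ∀ w : J × R → ℝ,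
      ∑ j, ((∑ r, w (j, r) * U j r) * (∑ r, w (j, r) * V j r) - ∑ r, U j r * V j r)
      = p * q / 4 * (∑ j, ((∑ r, w (j, r) * (U j r / p + 1 * (V j r / q))) ^ 2
            - ∑ r, (U j r / p + 1 * (V j r / q)) ^ 2)
          - ∑ j, ((∑ r, w (j, r) * (U j r / p + (-1) * (V j r / q))) ^ 2
            - ∑ r, (U j r / p + (-1) * (V j r / q)) ^ 2)) := by
    intro w
    rw [← Finset.sum_sub_distrib, Finset.mul_sum]
    refine Finset.sum_congr rfl fun j _ => ?_
    have e1 : ∀ σ : ℝ, ∑ r, w (j, r) * (U j r / p + σ * (V j r / q))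
        = (∑ r, w (j, r) * U j r) / p + σ * ((∑ r, w (j, r) * V j r) / q) := by
      intro σ
      rw [Finset.sum_div, Finset.sum_div, Finset.mul_sum, ← Finset.sum_add_distrib]
      exact Finset.sum_congr rfl fun r _ => by ring
    have e2 : ∑ r, (U j r / p + 1 * (V j r / q)) ^ 2 - ∑ r, (U j r / p + (-1) * (V j r / q)) ^ 2
        = 4 / (p * q) * ∑ r, U j r * V j r := by
      rw [← Finset.sum_sub_distrib, Finset.mul_sum]
      exact Finset.sum_congr rfl fun r _ => by field_simp; ring
    rw [e1, e1]
    have e3 : ∀ a b c d : ℝ, a - b - (c - d) = a - c - (b - d) := fun a b c d => by ring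
    rw [e3, e2]
    field_simp
    ring
  have hsub : {w : J × R → ℝ | x ≤ |∑ j, ((∑ r, w (j, r) * U j r) * (∑ r, w (j, r) * V j r)
        - ∑ r, U j r * V j r)|}
      ⊆ {w | 2 * x / (p * q) ≤ |∑ j, ((∑ r, w (j, r) * (U j r / p + 1 * (V j r / q))) ^ 2
            - ∑ r, (U j r / p + 1 * (V j r / q)) ^ 2)|} ∪
        {w | 2 * x / (p * q) ≤ |∑ j, ((∑ r, w (j, r) * (U j r / p + (-1) * (V j r / q))) ^ 2
            - ∑ r, (U j r / p + (-1) * (V j r / q)) ^ 2)|} := by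
    intro w hw
    simp only [Set.mem_ofPred_eq, Set.mem_union] at hw ⊢
    rw [hpol w, abs_mul, abs_of_pos (by positivity : 0 < p * q / 4)] at hw
    by_contra! hcon
    have h3 := (abs_sub _ _).trans_lt (add_lt_add hcon.1 hcon.2)
    have h4 := mul_lt_mul_of_pos_left h3 (by positivity : 0 < p * q / 4)
    have h5 : p * q / 4 * (2 * x / (p * q) + 2 * x / (p * q)) = x := by field_simp; ring
    linarith
  have hrate : min ((2 * x / (p * q)) ^ 2 / (K * 4 ^ 2)) (2 * x / (p * q) / 4) / 8
      ≥ min (x ^ 2 / (K * (p * q) ^ 2)) (x / (p * q)) / 32 := by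
    have h1 : (2 * x / (p * q)) ^ 2 / (K * 4 ^ 2) = x ^ 2 / (K * (p * q) ^ 2) / 4 := by
      field_simp; norm_num
    have h2 : 2 * x / (p * q) / 4 = x / (p * q) / 2 := by field_simp; norm_num
    rw [h1, h2]
    have h3 : 0 ≤ x / (p * q) := by positivity
    rcases min_cases (x ^ 2 / (K * (p * q) ^ 2) / 4) (x / (p * q) / 2) with ⟨h, -⟩ | ⟨h, -⟩ <;> rw [h]
    · linarith [min_le_left (x ^ 2 / (K * (p * q) ^ 2)) (x / (p * q))]
    · linarith [min_le_right (x ^ 2 / (K * (p * q) ^ 2)) (x / (p * q))]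
  have hexp := Real.exp_le_exp.2 (neg_le_neg hrate)
  refine (measureReal_mono hsub).trans ((measureReal_union_le _ _).trans ?_)
  have hq1 := hquad 1 (by norm_num)
  have hq2 := hquad (-1) (by norm_num)
  linarith

/-- Weighted sums of centred squares of distinct coordinates of a Gaussian vector concentrate. -/
lemma measure_abs_sum_sq_sub_one_ge_le {ι β : Type*} [Fintype ι] [Fintype β] (b : ι ↪ β)
    (c : ι → ℝ) (hc : ∀ i, |c i| ≤ 1) {K : ℝ} (hK : 0 < K) (hcard : (Fintype.card ι : ℝ) ≤ K)
    {x : ℝ} (hx : 0 < x) :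
    (Measure.pi fun _ : β => gaussianReal 0 1).real {g | x ≤ |∑ i, c i * (g (b i) ^ 2 - 1)|}
      ≤ 2 * Real.exp (-(min (x ^ 2 / K) x / 8)) := by
  have h0 : iIndepFun (fun (i : β) (g : β → ℝ) => g i) (Measure.pi fun _ : β => gaussianReal 0 1) :=
    iIndepFun_pi (X := fun i x => x) (fun i => by fun_prop)
  have hind := (h0.precomp b.injective).comp (fun i (y : ℝ) => c i * (y ^ 2 - ((1 : NNReal) : ℝ)))
    (fun i => by fun_prop)
  have := measure_abs_sum_ge_le_of_mgf_le hind
    (fun j => by simp only [Function.comp_def]; fun_prop) one_pos hK hcard ?_ hx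
  · simpa using this
  · intro i t ht
    exact mgf_sq_sub_gaussianReal_le (X := fun g : β → ℝ => g (b i)) (by fun_prop)
      (measurePreserving_eval (fun _ : β => gaussianReal 0 1) (b i)).map_eq (by simpa using hc i) ht

/-- The squared norm of a `K`-dimensional Gaussian vector exceeds `4 (K + t)` with probability at
most `2 exp (-t / 2)`. -/
lemma measure_sum_sq_ge_le {ι β : Type*} [Fintype ι] [Fintype β] (b : ι ↪ β) {K : ℝ} (hK : 0 < K)
    (hcard : (Fintype.card ι : ℝ) ≤ K) {t : ℝ} (ht : 0 ≤ t) :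
    (Measure.pi fun _ : β => gaussianReal 0 1).real {g | 4 * (K + t) ≤ ∑ i, g (b i) ^ 2}
      ≤ 2 * Real.exp (-(t / 2)) := by
  have h := measure_abs_sum_sq_sub_one_ge_le b (fun _ => 1) (by simp) hK hcard
    (x := 3 * K + 4 * t) (by positivity)
  refine (measureReal_mono ?_).trans (h.trans ?_)
  · intro g hg
    simp only [Set.mem_ofPred_eq, one_mul, Finset.sum_sub_distrib, Finset.sum_const,
      Finset.card_univ, nsmul_eq_mul, mul_one] at hg ⊢
    exact le_trans (by linarith) (le_abs_self _)
  · have h1 : 3 * K + 4 * t ≤ (3 * K + 4 * t) ^ 2 / K := by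
      rw [le_div_iff₀ hK]
      nlinarith [mul_nonneg hK.le ht]
    rw [min_eq_right h1]
    have := Real.exp_le_exp.2 (show -((3 * K + 4 * t) / 8) ≤ -(t / 2) by linarith)
    linarith

/-- Gaussian tail of a linear functional of a standard Gaussian vector. -/
lemma measure_abs_linear_ge_le {β : Type*} [Fintype β] (c : β → ℝ) {V : ℝ} (hV : 0 < V)
    (hc : ∑ i, c i ^ 2 ≤ V) {x : ℝ} (hx : 0 < x) :
    (Measure.pi fun _ : β => gaussianReal 0 1).real {g | x ≤ |∑ i, g i * c i|}
      ≤ 2 * Real.exp (-(x ^ 2 / (2 * V))) := by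
  have hlaw := map_linear_pi_gaussianReal c
  have hsub : HasSubgaussianMGF (fun g : β → ℝ => ∑ i, g i * c i) V.toNNReal
      (Measure.pi fun _ : β => gaussianReal 0 1) := by
    constructor
    · intro t
      have : Integrable (fun y => Real.exp (t * y))
          ((Measure.pi fun _ : β => gaussianReal 0 1).map (fun g : β → ℝ => ∑ i, g i * c i)) := by
        rw [hlaw]; exact integrable_exp_mul_gaussianReal t
      exact this.comp_measurable (by fun_prop)
    · intro t
      rw [mgf_gaussianReal hlaw]
      apply Real.exp_le_exp.2
      rw [Real.coe_toNNReal _ hV.le]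
      have : ((∑ i, (c i ^ 2).toNNReal : NNReal) : ℝ) = ∑ i, c i ^ 2 := by simp [sq_nonneg]
      rw [this]
      nlinarith [mul_le_mul_of_nonneg_right hc (sq_nonneg t)]
  have h1 := hsub.measure_ge_le hx.le
  have h2 := hsub.neg.measure_ge_le hx.le
  rw [Real.coe_toNNReal _ hV.le] at h1 h2
  have hcov : {g : β → ℝ | x ≤ |∑ i, g i * c i|} ⊆ {g | x ≤ ∑ i, g i * c i} ∪
      {g | x ≤ (-fun g : β → ℝ => ∑ i, g i * c i) g} := by
    intro g hg
    simp only [Set.mem_ofPred_eq, Set.mem_union, Pi.neg_apply] at hg ⊢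
    exact le_abs.1 hg
  refine (measureReal_mono hcov).trans ((measureReal_union_le _ _).trans ?_)
  rw [← neg_div]
  linarith

/-! ### Sampling without replacement -/

/-- Hoeffding's lemma for the uniform distribution on a finite type. -/
lemma sum_exp_mul_sub_mean_le {ι : Type*} [Fintype ι] [Nonempty ι] (c : ι → ℝ) {M : ℝ}
    (hc : ∀ i, |c i| ≤ M) (t : ℝ) :
    ∑ i, Real.exp (t * (c i - (∑ j, c j) / Fintype.card ι))
      ≤ Fintype.card ι * Real.exp (2 * t ^ 2 * M ^ 2) := by
  set N : ℝ := (Fintype.card ι : ℝ) with hN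
  have hN0 : 0 < N := by rw [hN]; exact_mod_cast Fintype.card_pos
  set μ := (∑ j, c j) / N with hμ
  have hμM : |μ| ≤ M := by
    rw [hμ, abs_div, abs_of_pos hN0, div_le_iff₀ hN0]
    refine (Finset.abs_sum_le_sum_abs _ _).trans ((Finset.sum_le_sum fun i _ => hc i).trans ?_)
    rw [Finset.sum_const, Finset.card_univ, nsmul_eq_mul, mul_comm]
  have hZ : ∀ i, |c i - μ| ≤ 2 * M := fun i =>
    (abs_sub _ _).trans (by linarith [hc i])
  have hM : 0 ≤ M := (abs_nonneg _).trans hμM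
  have hsum : ∑ i, (c i - μ) = 0 := by
    rw [Finset.sum_sub_distrib, Finset.sum_const, Finset.card_univ, nsmul_eq_mul, hμ]
    field_simp
    ring
  -- convexity of the exponential on an interval
  have hpt : ∀ i, Real.exp (t * (c i - μ))
      ≤ Real.cosh (t * (2 * M)) + (c i - μ) / (2 * M) * Real.sinh (t * (2 * M)) := by
    intro i
    rcases hM.eq_or_lt with h0 | h0
    · have : c i - μ = 0 := abs_eq_zero.1 (le_antisymm (by simpa [← h0] using hZ i) (abs_nonneg _))
      simp [this, ← h0]
    · have h1 : |(c i - μ) / (2 * M)| ≤ 1 := by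
        rw [abs_div, abs_of_pos (by positivity : 0 < 2 * M), div_le_one (by positivity)]
        exact hZ i
      have := Real.exp_mul_le_cosh_add_mul_sinh h1 (t * (2 * M))
      convert this using 2
      field_simp
  calc ∑ i, Real.exp (t * (c i - μ))
      ≤ ∑ i, (Real.cosh (t * (2 * M)) + (c i - μ) / (2 * M) * Real.sinh (t * (2 * M))) :=
        Finset.sum_le_sum fun i _ => hpt i
    _ = N * Real.cosh (t * (2 * M)) := by
        rw [Finset.sum_add_distrib, ← Finset.sum_mul, ← Finset.sum_div, hsum]
        simp [hN]
    _ ≤ N * Real.exp (2 * t ^ 2 * M ^ 2) := by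
        refine mul_le_mul_of_nonneg_left ((Real.cosh_le_exp_half_sq _).trans ?_) hN0.le
        exact Real.exp_le_exp.2 (by nlinarith)

/-- Moment generating function of a sample sum without replacement. Given the first `s` draws, the
centred sum of `s + 1` draws is the centred sum of the first `s` draws, shrunk by the factor
`1 - 1 / (N - s)`, plus a conditionally centred term, to which Hoeffding's lemma applies. -/
lemma sum_exp_embedding_le {β : Type*} [Fintype β] [DecidableEq β] (c : β → ℝ) {M : ℝ}
    (hc : ∀ i, |c i| ≤ M) (s : ℕ) (hs : s ≤ Fintype.card β) (t : ℝ) :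
    ∑ e : Fin s ↪ β, Real.exp (t * (∑ p, c (e p) - s * ((∑ i, c i) / Fintype.card β)))
      ≤ Fintype.card (Fin s ↪ β) * Real.exp (2 * s * t ^ 2 * M ^ 2) := by
  induction s generalizing t with
  | zero => simp
  | succ s ih =>
    set N : ℝ := (Fintype.card β : ℝ) with hN
    set μ := (∑ i, c i) / N with hμ
    have hsN : (0 : ℝ) < N - s := by
      rw [hN, sub_pos]; exact_mod_cast hs
    have h1N : (1 : ℝ) ≤ N - s := by
      rw [hN, le_sub_iff_add_le]; exact_mod_cast (by omega : 1 + s ≤ Fintype.card β)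
    have hN0 : 0 < N := by linarith [(Nat.cast_nonneg s : (0 : ℝ) ≤ s)]
    rw [← (Equiv.embeddingFinSucc s β).symm.sum_comp, Fintype.sum_sigma]
    have hcard : ∀ e : Fin s ↪ β, (Fintype.card {i // i ∉ Set.range e} : ℝ) = N - s := by
      intro e
      have h1 : Fintype.card {i // i ∉ Set.range e} = Fintype.card β - s := by
        rw [Fintype.card_subtype_compl]
        congr 1
        have := Set.card_range_of_injective e.injective
        rw [Fintype.card_fin] at this
        convert this
      rw [h1, Nat.cast_sub (by omega), hN]
    -- the sum over the next draw, which is uniform on the `N - s` remaining points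
    have hinner : ∀ e : Fin s ↪ β,
        ∑ i : {i // i ∉ Set.range e}, Real.exp (t * (∑ p, c ((Equiv.embeddingFinSucc s β).symm ⟨e, i⟩ p)
            - ((s + 1 : ℕ) : ℝ) * μ))
          ≤ (N - s) * Real.exp (2 * t ^ 2 * M ^ 2)
            * Real.exp (t * (1 - 1 / (N - s)) * (∑ p, c (e p) - s * μ)) := by
      intro e
      have : Nonempty {i // i ∉ Set.range e} := by
        rw [← Fintype.card_pos_iff]
        have := hcard e
        exact_mod_cast this ▸ hsN
      have hsumc : ∑ i : {i // i ∉ Set.range e}, c i = N * μ - ∑ p, c (e p) := by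
        have h2 : ∑ i : {i // i ∈ Set.range e}, c i = ∑ p, c (e p) := by
          rw [← (Equiv.ofInjective e e.injective).sum_comp]
          rfl
        have h3 : N * μ = ∑ i, c i := by rw [hμ]; field_simp
        rw [h3, ← h2, eq_sub_iff_add_eq, add_comm]
        convert Fintype.sum_subtype_add_sum_subtype (fun i => i ∈ Set.range e) c
      have hh := sum_exp_mul_sub_mean_le (fun i : {i // i ∉ Set.range e} => c i) (fun i => hc i) t
      rw [hcard e, hsumc] at hh
      refine le_trans (le_of_eq ?_) (mul_le_mul_of_nonneg_right hh
        (Real.exp_pos (t * (1 - 1 / (N - s)) * (∑ p, c (e p) - s * μ))).le)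
      rw [Finset.sum_mul]
      refine Finset.sum_congr rfl fun i _ => ?_
      rw [← Real.exp_add]
      congr 1
      rw [Equiv.coe_embeddingFinSucc_symm, Fin.sum_univ_succ]
      simp only [Fin.cons_zero, Fin.cons_succ]
      push_cast
      field_simp
      ring
    refine (Finset.sum_le_sum fun e _ => hinner e).trans ?_
    rw [← Finset.mul_sum]
    refine (mul_le_mul_of_nonneg_left (ih (by omega) _) (by positivity)).trans ?_
    have hc1 : (Fintype.card (Fin (s + 1) ↪ β) : ℝ) = (N - s) * Fintype.card (Fin s ↪ β) := by
      rw [Fintype.card_embedding_eq, Fintype.card_embedding_eq, Fintype.card_fin, Fintype.card_fin,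
        Nat.descFactorial_succ, Nat.cast_mul, Nat.cast_sub (by omega)]
    rw [hc1]
    have hsh : (t * (1 - 1 / (N - s))) ^ 2 ≤ t ^ 2 := by
      rw [mul_pow]
      refine mul_le_of_le_one_right (sq_nonneg t) ?_
      have h2 : 0 < 1 / (N - s) := by positivity
      have h3 : 1 / (N - s) ≤ 1 := by rw [div_le_one hsN]; exact h1N
      nlinarith
    have hexp : Real.exp (2 * t ^ 2 * M ^ 2) * Real.exp (2 * s * (t * (1 - 1 / (N - s))) ^ 2 * M ^ 2)
        ≤ Real.exp (2 * ((s + 1 : ℕ) : ℝ) * t ^ 2 * M ^ 2) := by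
      rw [← Real.exp_add]
      apply Real.exp_le_exp.2
      push_cast
      have := mul_le_mul_of_nonneg_left hsh (by positivity : 0 ≤ 2 * (s : ℝ) * M ^ 2)
      nlinarith
    have h4 : 0 ≤ (N - s) * (Fintype.card (Fin s ↪ β) : ℝ) := by positivity
    calc _ = (N - s) * (Fintype.card (Fin s ↪ β) : ℝ) * (Real.exp (2 * t ^ 2 * M ^ 2)
          * Real.exp (2 * s * (t * (1 - 1 / (N - s))) ^ 2 * M ^ 2)) := by ring
      _ ≤ _ := mul_le_mul_of_nonneg_left hexp h4

namespace NoisyWtdLLP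

instance (m k n : ℕ) : MeasurableSingletonClass (Bags m k n) := ⟨fun _ => trivial⟩

lemma nonempty_bags {m k n : ℕ} (h : m * k ≤ n) : Nonempty (Bags m k n) :=
  Function.Embedding.nonempty_of_card_le (by simpa using h)

lemma isProbabilityMeasure_uniformOn_bags {m k n : ℕ} (h : m * k ≤ n) :
    IsProbabilityMeasure (uniformOn (Set.univ : Set (Bags m k n))) := by
  have := nonempty_bags h
  exact isProbabilityMeasure_uniformOn Set.finite_univ Set.univ_nonempty

lemma uniformOn_bags_sum_ge_le {m k n : ℕ} (hm : 0 < m) (hk : 0 < k) (h : m * k ≤ n)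
    (c : Fin n → ℝ) {M : ℝ} (hM : 0 < M) (hc : ∀ i, |c i| ≤ M) {x : ℝ} (hx : 0 < x) :
    (uniformOn (Set.univ : Set (Bags m k n))).real
        {b | x ≤ 1 / ((m : ℝ) * k) * ∑ p, c (b p) - 1 / (n : ℝ) * ∑ i, c i}
      ≤ Real.exp (-((m : ℝ) * k * x ^ 2 / (8 * M ^ 2))) := by
  classical
  have hne := nonempty_bags h
  set s : ℝ := (m : ℝ) * k with hs
  have hs0 : 0 < s := by positivity
  set S := {b : Bags m k n | x ≤ 1 / s * ∑ p, c (b p) - 1 / (n : ℝ) * ∑ i, c i} with hS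
  -- the minimizer of the Chernoff exponent `2 s t² M² - t s x`
  set t : ℝ := x / (4 * M ^ 2) with ht
  have ht0 : 0 < t := by positivity
  have hcardpos : (0 : ℝ) < Fintype.card (Bags m k n) := by exact_mod_cast Fintype.card_pos
  -- the moment generating function, transported from `Fin (m * k) ↪ Fin n`
  have hmgf : ∑ b : Bags m k n, Real.exp (t * (∑ p, c (b p) - s * ((∑ i, c i) / n)))
      ≤ Fintype.card (Bags m k n) * Real.exp (2 * s * t ^ 2 * M ^ 2) := by
    have h1 := sum_exp_embedding_le c hc (m * k) (by simpa using h) t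
    have E : Bags m k n ≃ (Fin (m * k) ↪ Fin n) :=
      Equiv.embeddingCongr finProdFinEquiv (Equiv.refl _)
    rw [← (Equiv.embeddingCongr (finProdFinEquiv (m := m) (n := k)) (Equiv.refl (Fin n))).sum_comp,
      ← Fintype.card_congr E] at h1
    simp only [Fintype.card_fin] at h1
    push_cast at h1
    refine le_trans (le_of_eq (Finset.sum_congr rfl fun b _ => ?_)) h1
    rw [← finProdFinEquiv.sum_comp]
    simp [hs]
  have hcount : ((Finset.univ.filter fun b => b ∈ S).card : ℝ) * Real.exp (t * (s * x))
      ≤ Fintype.card (Bags m k n) * Real.exp (2 * s * t ^ 2 * M ^ 2) := by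
    refine le_trans ?_ hmgf
    rw [← nsmul_eq_mul, ← Finset.sum_const]
    refine (Finset.sum_le_sum fun b hb => ?_).trans
      (Finset.sum_le_sum_of_subset_of_nonneg (Finset.filter_subset _ _)
        fun b _ _ => (Real.exp_pos _).le)
    apply Real.exp_le_exp.2
    refine mul_le_mul_of_nonneg_left ?_ ht0.le
    have hb' : x ≤ 1 / s * ∑ p, c (b p) - 1 / (n : ℝ) * ∑ i, c i := by simpa [hS] using hb
    calc s * x ≤ s * (1 / s * ∑ p, c (b p) - 1 / (n : ℝ) * ∑ i, c i) :=
          mul_le_mul_of_nonneg_left hb' hs0.le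
      _ = _ := by field_simp
  have hval : (uniformOn (Set.univ : Set (Bags m k n))).real S
      = ((Finset.univ.filter fun b => b ∈ S).card : ℝ) / Fintype.card (Bags m k n) := by
    rw [measureReal_def, uniformOn_univ, ENNReal.toReal_div]
    congr 1
    have hSf : S = ((Finset.univ.filter fun b => b ∈ S : Finset (Bags m k n)) : Set (Bags m k n)) := by
      ext b; simp
    conv_lhs => rw [hSf, Measure.count_apply_finset]
    simp
  rw [hval, div_le_iff₀ hcardpos]
  have hexp : Real.exp (2 * s * t ^ 2 * M ^ 2)
      = Real.exp (-(s * x ^ 2 / (8 * M ^ 2))) * Real.exp (t * (s * x)) := by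
    rw [← Real.exp_add]
    congr 1
    rw [ht]
    field_simp
    ring
  rw [hexp, ← mul_assoc (Fintype.card (Bags m k n) : ℝ)] at hcount
  rw [mul_comm (Real.exp _)]
  exact le_of_mul_le_mul_right hcount (Real.exp_pos _)

/-- Hoeffding's inequality for sampling without replacement: the average of a bounded function over
the members of all the bags is close to its average over the whole dataset. -/
lemma uniformOn_bags_abs_sum_ge_le {m k n : ℕ} (hm : 0 < m) (hk : 0 < k) (h : m * k ≤ n)
    (c : Fin n → ℝ) {M : ℝ} (hM : 0 < M) (hc : ∀ i, |c i| ≤ M) {x : ℝ} (hx : 0 < x) :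
    (uniformOn (Set.univ : Set (Bags m k n))).real
        {b | x ≤ |1 / ((m : ℝ) * k) * ∑ p, c (b p) - 1 / (n : ℝ) * ∑ i, c i|}
      ≤ 2 * Real.exp (-((m : ℝ) * k * x ^ 2 / (8 * M ^ 2))) := by
  have := isProbabilityMeasure_uniformOn_bags h
  have h1 := uniformOn_bags_sum_ge_le hm hk h c hM hc hx
  have h2 := uniformOn_bags_sum_ge_le hm hk h (fun i => -c i) hM (by simpa using hc) hx
  refine (measureReal_mono (s₂ := {b | x ≤ 1 / ((m : ℝ) * k) * ∑ p, c (b p) - 1 / (n : ℝ) * ∑ i, c i} ∪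
    {b | x ≤ 1 / ((m : ℝ) * k) * ∑ p, -c (b p) - 1 / (n : ℝ) * ∑ i, -c i}) ?_).trans
      ((measureReal_union_le _ _).trans (by linarith))
  intro b hb
  rw [Set.mem_ofPred_eq] at hb
  rcases le_abs.1 hb with h | h
  · exact Or.inl h
  · refine Or.inr ?_
    simp only [Set.mem_ofPred_eq, Finset.sum_neg_distrib] at h ⊢
    linarith

/-! ### Conditioning on a part of the randomness -/

/-- An event whose probability given the bags is always at most `q` has probability at most `q`. -/
lemma law_real_le_of_bags {m k n : ℕ} (h : m * k ≤ n) (S : Set (Randomness m k n)) {q : ℝ}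
    (hq : 0 ≤ q)
    (hS : ∀ b, ((Measure.pi fun _ : Fin m × Fin k => gaussianReal 0 1).prod
      (Measure.pi fun _ : Fin n => gaussianReal 0 1)).real {p | (b, p) ∈ S} ≤ q) :
    (law m k n).real S ≤ q := by
  have := isProbabilityMeasure_uniformOn_bags h
  set ν := (Measure.pi fun _ : Fin m × Fin k => gaussianReal 0 1).prod
      (Measure.pi fun _ : Fin n => gaussianReal 0 1) with hν
  have hcov : S ⊆ ⋃ b : Bags m k n, {b} ×ˢ {p | (b, p) ∈ S} := by
    rintro ⟨b, p⟩ hp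
    simpa using hp
  refine ENNReal.toReal_le_of_le_ofReal hq ?_
  calc law m k n S ≤ ∑ b : Bags m k n, law m k n ({b} ×ˢ {p | (b, p) ∈ S}) :=
        (measure_mono hcov).trans (measure_iUnion_fintype_le _ _)
    _ = ∑ b : Bags m k n, uniformOn (Set.univ : Set (Bags m k n)) {b} * ν {p | (b, p) ∈ S} := by
        refine Finset.sum_congr rfl fun b _ => ?_
        rw [law, Measure.prod_prod]
    _ ≤ ∑ b : Bags m k n, uniformOn (Set.univ : Set (Bags m k n)) {b} * ENNReal.ofReal q := by
        refine Finset.sum_le_sum fun b _ => mul_le_mul_right ?_ _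
        rw [← ofReal_measureReal (measure_ne_top _ _)]
        exact ENNReal.ofReal_le_ofReal (hS b)
    _ = ENNReal.ofReal q := by
        rw [← Finset.sum_mul, sum_measure_singleton]
        simp

lemma law_real_bags_event {m k n : ℕ} (T : Set (Bags m k n)) :
    (law m k n).real {ω | ω.1 ∈ T} = (uniformOn (Set.univ : Set (Bags m k n))).real T := by
  have : {ω : Randomness m k n | ω.1 ∈ T} = T ×ˢ Set.univ := by ext; simp
  rw [this, law, measureReal_def, Measure.prod_prod]
  simp [measureReal_def]

/-- An event in a product whose sections in the first variable all have probability at most `q` has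
probability at most `q`. -/
lemma prod_real_le_of_sections {α β : Type*} [MeasurableSpace α] [MeasurableSpace β] (μ : Measure α)
    (ν : Measure β) [IsProbabilityMeasure μ] [IsProbabilityMeasure ν] {S : Set (α × β)}
    (hS : MeasurableSet S) {q : ℝ} (hq : 0 ≤ q) (h : ∀ y, μ.real {x | (x, y) ∈ S} ≤ q) :
    (μ.prod ν).real S ≤ q := by
  refine ENNReal.toReal_le_of_le_ofReal hq ?_
  rw [Measure.prod_apply_symm hS]
  calc ∫⁻ y, μ ((fun x => (x, y)) ⁻¹' S) ∂ν ≤ ∫⁻ _y, ENNReal.ofReal q ∂ν := by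
        refine lintegral_mono fun y => ?_
        rw [← ofReal_measureReal (measure_ne_top _ _)]
        exact ENNReal.ofReal_le_ofReal (h y)
    _ = ENNReal.ofReal q := by simp

lemma prod_real_snd_event {α β : Type*} [MeasurableSpace α] [MeasurableSpace β] (μ : Measure α)
    (ν : Measure β) [IsProbabilityMeasure μ] [IsProbabilityMeasure ν] {T : Set β} :
    (μ.prod ν).real {p | p.2 ∈ T} = ν.real T := by
  have : {p : α × β | p.2 ∈ T} = Set.univ ×ˢ T := by ext; simp
  rw [this, measureReal_def, Measure.prod_prod]
  simp [measureReal_def]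

/-! ### The deviation as a bilinear form -/

/-- The deviation of the weighted bag form from the average over the whole dataset, as a bilinear
form in two vectors of residuals; its diagonal values are the quantities to be bounded. -/
noncomputable def dev {m k n : ℕ} (b : Bags m k n) (w : Fin m × Fin k → ℝ) (u v : Fin n → ℝ) : ℝ :=
  1 / ((m : ℝ) * k) * ∑ j, (∑ r, w (j, r) * u (b (j, r))) * (∑ r, w (j, r) * v (b (j, r)))
    - 1 / (n : ℝ) * ∑ i, u i * v i

/-- The part of the deviation that is due to the random weights, the bags being given. -/
noncomputable def weightDev {m k n : ℕ} (b : Bags m k n) (w : Fin m × Fin k → ℝ) (u v : Fin n → ℝ) : ℝ :=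
  1 / ((m : ℝ) * k) * ∑ j, ((∑ r, w (j, r) * u (b (j, r))) * (∑ r, w (j, r) * v (b (j, r)))
    - ∑ r, u (b (j, r)) * v (b (j, r)))

/-- The part of the deviation that is due to the random choice of the bags. -/
noncomputable def sampleDev {m k n : ℕ} (b : Bags m k n) (u v : Fin n → ℝ) : ℝ :=
  1 / ((m : ℝ) * k) * ∑ p, u (b p) * v (b p) - 1 / (n : ℝ) * ∑ i, u i * v i

/-- The label noise: the Gaussian `g i` on the noisy indices and `0` elsewhere. -/
noncomputable def noise {n : ℕ} (N : Finset (Fin n)) (g : Fin n → ℝ) (i : Fin n) : ℝ :=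
  if i ∈ N then g i else 0

lemma dev_eq_add {m k n : ℕ} (b : Bags m k n) (w : Fin m × Fin k → ℝ) (u v : Fin n → ℝ) :
    dev b w u v = weightDev b w u v + sampleDev b u v := by
  rw [dev, weightDev, sampleDev, Finset.sum_sub_distrib, Fintype.sum_prod_type]
  ring

lemma noise_sq_le {n : ℕ} (N : Finset (Fin n)) (g : Fin n → ℝ) (i : Fin n) :
    noise N g i ^ 2 ≤ g i ^ 2 := by
  unfold noise
  split_ifs
  · exact le_rfl
  · simpa using sq_nonneg (g i)

lemma measurable_noise {n : ℕ} (N : Finset (Fin n)) : Measurable (noise N) := by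
  refine measurable_pi_iff.2 fun i => ?_
  unfold noise
  split_ifs <;> fun_prop

/-- No bag carries much noise. -/
def lightNoise {m k n : ℕ} (t : ℝ) (b : Bags m k n) : Set (Fin n → ℝ) :=
  {g | ∀ j, ∑ r, g (b (j, r)) ^ 2 < 4 * ((k : ℝ) + t)}

/-- The proportion of noisy indices in the bags is not much larger than in the whole dataset. -/
def balancedBags {m k n : ℕ} (N : Finset (Fin n)) (t : ℝ) : Set (Bags m k n) :=
  {b | 1 / ((m : ℝ) * k) * ∑ p, (if b p ∈ N then (1 : ℝ) else 0) < (N.card : ℝ) / n + 1 / t}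

lemma measurableSet_lightNoise {m k n : ℕ} (t : ℝ) (b : Bags m k n) :
    MeasurableSet (lightNoise t b) := by
  have : lightNoise t b = ⋂ j, {g | ∑ r, g (b (j, r)) ^ 2 < 4 * ((k : ℝ) + t)} := by
    ext; simp [lightNoise]
  rw [this]
  exact MeasurableSet.iInter fun j => measurableSet_lt (by fun_prop) (by fun_prop)

/-! ### Tail bounds for the deviation of fixed vectors -/

/-- Tail of the weight part, uniformly over the bags and over noise vectors in a given set on which
the bag norms of the two residual vectors are bounded. -/
lemma law_weightDev_ge_le {m k n : ℕ} (hm : 0 < m) (hk : 0 < k) (h : m * k ≤ n)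
    {u v : (Fin n → ℝ) → Fin n → ℝ} (hu : Measurable u) (hv : Measurable v)
    {G : Bags m k n → Set (Fin n → ℝ)} (hG : ∀ b, MeasurableSet (G b)) {p q : ℝ} (hp : 0 < p)
    (hq : 0 < q) (hup : ∀ b, ∀ g ∈ G b, ∀ j, ∑ r, u g (b (j, r)) ^ 2 ≤ p ^ 2)
    (hvq : ∀ b, ∀ g ∈ G b, ∀ j, ∑ r, v g (b (j, r)) ^ 2 ≤ q ^ 2) {x : ℝ} (hx : 0 < x) :
    (law m k n).real
        {ω | ω.2.2 ∈ G ω.1 ∧ x ≤ |weightDev ω.1 ω.2.1 (u ω.2.2) (v ω.2.2)|}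
      ≤ 4 * Real.exp (-(min (((m : ℝ) * k * x) ^ 2 / (m * (p * q) ^ 2))
          ((m : ℝ) * k * x / (p * q)) / 32)) := by
  have hmk : (0 : ℝ) < (m : ℝ) * k := by positivity
  refine law_real_le_of_bags h _ (by positivity) fun b => ?_
  have hu' : ∀ i, Measurable fun g => u g i := fun i => (measurable_pi_apply i).comp hu
  have hv' : ∀ i, Measurable fun g => v g i := fun i => (measurable_pi_apply i).comp hv
  refine prod_real_le_of_sections _ _ ?_ (by positivity) fun g => ?_
  · have hmeas : Measurable fun p : (Fin m × Fin k → ℝ) × (Fin n → ℝ) =>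
        |weightDev b p.1 (u p.2) (v p.2)| := by
      unfold weightDev
      fun_prop
    exact ((hG b).preimage measurable_snd).inter (measurableSet_le measurable_const hmeas)
  · by_cases hg : g ∈ G b
    · have hb := measure_abs_bilinear_ge_le (fun j r => u g (b (j, r))) (fun j r => v g (b (j, r)))
        hp hq (by positivity : (0 : ℝ) < m) (by simp) (hup b g hg) (hvq b g hg)
        (by positivity : 0 < (m : ℝ) * k * x)
      refine (measureReal_mono ?_).trans hb
      rintro w ⟨-, hw⟩
      simp only [Set.mem_ofPred_eq] at hw ⊢
      rw [weightDev, abs_mul, abs_of_pos (by positivity), one_div, ← div_eq_inv_mul,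
        le_div_iff₀ hmk] at hw
      linarith
    · have : {w : Fin m × Fin k → ℝ | (w, g) ∈ {p : (Fin m × Fin k → ℝ) × (Fin n → ℝ) | (b, p) ∈
          {ω : Randomness m k n | ω.2.2 ∈ G ω.1 ∧
            x ≤ |weightDev ω.1 ω.2.1 (u ω.2.2) (v ω.2.2)|}}} = ∅ := by
        ext w; simp [hg]
      rw [this, measureReal_empty]
      positivity

lemma min_sq_div_four_le {t : ℝ} (ht : 0 ≤ t) :
    min (t ^ 2) t / 4 ≤ min ((t / 2) ^ 2) (t / 2) := by
  refine le_min ?_ ?_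
  · nlinarith [min_le_left (t ^ 2) t]
  · linarith [min_le_right (t ^ 2) t]

/-- Deviation of two bounded vectors. -/
lemma law_dev_ge_le {m k n : ℕ} (hm : 0 < m) (hk : 0 < k) (h : m * k ≤ n) {u v : Fin n → ℝ}
    {α β : ℝ} (hα : 0 < α) (hβ : 0 < β) (hu : ∀ i, |u i| ≤ α) (hv : ∀ i, |v i| ≤ β) {x : ℝ}
    (hx : 0 < x) :
    (law m k n).real {ω | x ≤ |dev ω.1 ω.2.1 u v|}
      ≤ 6 * Real.exp (-(m * min ((x / (α * β)) ^ 2) (x / (α * β)) / 128)) := by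
  have := isProbabilityMeasure_law h
  have hm' : (0 : ℝ) < m := by exact_mod_cast hm
  have hk' : (1 : ℝ) ≤ k := by exact_mod_cast hk
  have hk0 : (0 : ℝ) < k := by linarith
  set τ := x / (α * β) with hτ
  have hτ0 : 0 < τ := by positivity
  have hbag : ∀ {f : Fin n → ℝ} {a : ℝ}, 0 < a → (∀ i, |f i| ≤ a) → ∀ (b : Bags m k n) (j : Fin m),
      ∑ r, f (b (j, r)) ^ 2 ≤ (√(k : ℝ) * a) ^ 2 := by
    intro f a ha hf b j
    rw [mul_pow, Real.sq_sqrt hk0.le]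
    refine (Finset.sum_le_sum fun r _ => (sq_abs (f (b (j, r)))).symm.le.trans
      (pow_le_pow_left₀ (abs_nonneg _) (hf _) 2)).trans ?_
    simp
  have h1 := law_weightDev_ge_le hm hk h (u := fun _ => u) (v := fun _ => v) measurable_const
    measurable_const (G := fun _ => Set.univ) (fun _ => MeasurableSet.univ)
    (p := √(k : ℝ) * α) (q := √(k : ℝ) * β) (by positivity) (by positivity)
    (fun b _ _ j => hbag hα hu b j) (fun b _ _ j => hbag hβ hv b j) (x := x / 2) (by positivity)
  have h2 := uniformOn_bags_abs_sum_ge_le hm hk h (fun i => u i * v i) (M := α * β) (by positivity)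
    (fun i => by rw [abs_mul]; exact mul_le_mul (hu i) (hv i) (abs_nonneg _) hα.le)
    (x := x / 2) (by positivity)
  rw [← law_real_bags_event] at h2
  have hpq : √(k : ℝ) * α * (√(k : ℝ) * β) = k * (α * β) := by
    rw [mul_mul_mul_comm, Real.mul_self_sqrt hk0.le]
  have hmin0 : 0 ≤ min (τ ^ 2) τ := le_min (by positivity) hτ0.le
  have e1 : 4 * Real.exp (-(min (((m : ℝ) * k * (x / 2)) ^ 2 / (m * (√(k : ℝ) * α * (√(k : ℝ) * β)) ^ 2))
          ((m : ℝ) * k * (x / 2) / (√(k : ℝ) * α * (√(k : ℝ) * β))) / 32))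
      ≤ 4 * Real.exp (-(m * min (τ ^ 2) τ / 128)) := by
    refine mul_le_mul_of_nonneg_left (Real.exp_le_exp.2 (neg_le_neg ?_)) (by norm_num)
    rw [hpq]
    have e3 : ((m : ℝ) * k * (x / 2)) ^ 2 / (m * (k * (α * β)) ^ 2) = m * (τ / 2) ^ 2 := by
      rw [hτ]; field_simp
    have e4 : (m : ℝ) * k * (x / 2) / (k * (α * β)) = m * (τ / 2) := by
      rw [hτ]; field_simp
    rw [e3, e4, ← mul_min_of_nonneg _ _ hm'.le]
    have := mul_le_mul_of_nonneg_left (min_sq_div_four_le hτ0.le) hm'.le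
    linarith
  have e2 : 2 * Real.exp (-((m : ℝ) * k * (x / 2) ^ 2 / (8 * (α * β) ^ 2)))
      ≤ 2 * Real.exp (-(m * min (τ ^ 2) τ / 128)) := by
    refine mul_le_mul_of_nonneg_left (Real.exp_le_exp.2 (neg_le_neg ?_)) (by norm_num)
    have e3 : (m : ℝ) * k * (x / 2) ^ 2 / (8 * (α * β) ^ 2) = k * (m * τ ^ 2) / 32 := by
      rw [hτ]; field_simp; norm_num
    rw [e3]
    have := mul_le_mul_of_nonneg_left (min_le_left (τ ^ 2) τ) hm'.le
    have h4 : m * τ ^ 2 ≤ k * (m * τ ^ 2) := le_mul_of_one_le_left (by positivity) hk'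
    have h5 : 0 ≤ m * τ ^ 2 := by positivity
    linarith
  refine (measureReal_mono (s₂ := {ω | ω.2.2 ∈ (Set.univ : Set (Fin n → ℝ)) ∧
      x / 2 ≤ |weightDev ω.1 ω.2.1 u v|} ∪ {ω | ω.1 ∈ {b : Bags m k n |
        x / 2 ≤ |1 / ((m : ℝ) * k) * ∑ p, u (b p) * v (b p) - 1 / (n : ℝ) * ∑ i, u i * v i|}}) ?_).trans
    ((measureReal_union_le _ _).trans (by linarith))
  intro ω hω
  rw [Set.mem_ofPred_eq, dev_eq_add] at hω
  by_contra hcon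
  simp only [Set.mem_union, Set.mem_ofPred_eq, Set.mem_univ, true_and, not_or, not_le] at hcon
  have := (abs_add_le _ _).trans_lt (add_lt_add hcon.1 hcon.2)
  rw [sampleDev] at hω
  linarith

/-- Sums over the members of all the bags, written as sums over the dataset; the members of the bags
are distinct. -/
lemma sum_comp_bags {m k n : ℕ} (b : Bags m k n) (f : Fin n → ℝ) :
    ∑ p, f (b p) = ∑ i, (if i ∈ Finset.univ.map b then 1 else 0) * f i := by
  simp only [ite_mul, one_mul, zero_mul, Finset.sum_ite_mem, Finset.univ_inter, Finset.sum_map]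

/-- Sampling deviation of a bounded vector against the noise, for balanced bags. -/
lemma law_sampleDev_noise_ge_le {m k n : ℕ} (hm : 0 < m) (hk : 0 < k) (h : m * k ≤ n)
    (N : Finset (Fin n)) {u : Fin n → ℝ} {α t : ℝ} (hα : 0 < α) (ht : 0 < t)
    (hu : ∀ i, |u i| ≤ α) {x : ℝ} (hx : 0 < x) :
    (law m k n).real {ω | ω.1 ∈ balancedBags N t ∧ x ≤ |sampleDev ω.1 u (noise N ω.2.2)|}
      ≤ 2 * Real.exp (-(m * k * (x / α) ^ 2 / (8 * ((N.card : ℝ) / n + 1 / t)))) := by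
  have hm' : (0 : ℝ) < m := by exact_mod_cast hm
  have hk' : (0 : ℝ) < k := by exact_mod_cast hk
  have hmk : (0 : ℝ) < (m : ℝ) * k := by positivity
  have hmkn : (m : ℝ) * k ≤ n := by exact_mod_cast h
  have hn : (0 : ℝ) < n := by linarith
  set ρ := (N.card : ℝ) / n with hρ
  have hρ0 : 0 ≤ ρ := by positivity
  have hρt : 0 < ρ + 1 / t := by positivity
  refine law_real_le_of_bags h _ (by positivity) fun b => ?_
  by_cases hb : b ∈ balancedBags N t
  swap
  · have : {p : (Fin m × Fin k → ℝ) × (Fin n → ℝ) | (b, p) ∈ {ω : Randomness m k n |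
        ω.1 ∈ balancedBags N t ∧ x ≤ |sampleDev ω.1 u (noise N ω.2.2)|}} = ∅ := by
      ext w; simp [hb]
    rw [this, measureReal_empty]
    positivity
  have hset : {p : (Fin m × Fin k → ℝ) × (Fin n → ℝ) | (b, p) ∈ {ω : Randomness m k n |
        ω.1 ∈ balancedBags N t ∧ x ≤ |sampleDev ω.1 u (noise N ω.2.2)|}}
      = {p | p.2 ∈ {g | x ≤ |sampleDev b u (noise N g)|}} := by
    ext p; simp [hb]
  rw [hset, prod_real_snd_event]
  set I : Fin n → ℝ := fun i => if i ∈ Finset.univ.map b then 1 else 0 with hI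
  set c : Fin n → ℝ := fun i => (if i ∈ N then 1 else 0) * u i * (I i / ((m : ℝ) * k) - 1 / n) with hc
  -- for fixed bags the deviation is a linear form in `g`, whose variance `hV` bounds
  have hlin : ∀ g, sampleDev b u (noise N g) = ∑ i, g i * c i := by
    intro g
    rw [sampleDev, sum_comp_bags b (fun i => u i * noise N g i), Finset.mul_sum, Finset.mul_sum,
      ← Finset.sum_sub_distrib]
    refine Finset.sum_congr rfl fun i _ => ?_
    change 1 / ((m : ℝ) * k) * (I i * (u i * noise N g i)) - 1 / n * (u i * noise N g i) = _
    simp only [hc, noise]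
    by_cases hiN : i ∈ N
    · simp only [hiN, if_true]; ring
    · simp [hiN]
  have hsum : ∑ i, (if i ∈ N then (1 : ℝ) else 0) = N.card := by simp
  have hV : ∑ i, c i ^ 2 ≤ 4 * α ^ 2 * (ρ + 1 / t) / ((m : ℝ) * k) := by
    have hpt : ∀ i, c i ^ 2 ≤ 2 * α ^ 2 / ((m : ℝ) * k) ^ 2 * (I i * (if i ∈ N then 1 else 0))
        + 2 * α ^ 2 / (n : ℝ) ^ 2 * (if i ∈ N then 1 else 0) := by
      intro i
      have hu2 : u i ^ 2 ≤ α ^ 2 := by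
        rw [← sq_abs]; exact pow_le_pow_left₀ (abs_nonneg _) (hu i) 2
      by_cases hiN : i ∈ N
      · have hI2 : I i ^ 2 = I i := by simp only [hI]; split_ifs <;> norm_num
        have h1 : (I i / ((m : ℝ) * k) - 1 / n) ^ 2
            ≤ 2 * (I i / ((m : ℝ) * k) ^ 2) + 2 * (1 / (n : ℝ) ^ 2) := by
          have h3 : I i / ((m : ℝ) * k) ^ 2 = (I i / ((m : ℝ) * k)) ^ 2 := by rw [div_pow, hI2]
          have h4 : 1 / (n : ℝ) ^ 2 = (1 / (n : ℝ)) ^ 2 := by rw [div_pow, one_pow]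
          rw [h3, h4]
          nlinarith [sq_nonneg (I i / ((m : ℝ) * k) + 1 / n)]
        simp only [hc, hiN, if_true, one_mul, mul_one]
        calc (u i * (I i / ((m : ℝ) * k) - 1 / n)) ^ 2
            = u i ^ 2 * (I i / ((m : ℝ) * k) - 1 / n) ^ 2 := by ring
          _ ≤ α ^ 2 * (2 * (I i / ((m : ℝ) * k) ^ 2) + 2 * (1 / (n : ℝ) ^ 2)) :=
              mul_le_mul hu2 h1 (sq_nonneg _) (sq_nonneg _)
          _ = _ := by ring
      · simp [hc, hiN]
    have hbal : 1 / ((m : ℝ) * k) * ∑ i, I i * (if i ∈ N then (1 : ℝ) else 0) < ρ + 1 / t := by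
      have := sum_comp_bags b (fun i => if i ∈ N then (1 : ℝ) else 0)
      rw [← this]
      exact hb
    calc ∑ i, c i ^ 2 ≤ _ := Finset.sum_le_sum fun i _ => hpt i
      _ = 2 * α ^ 2 / ((m : ℝ) * k) * (1 / ((m : ℝ) * k) * ∑ i, I i * (if i ∈ N then (1 : ℝ) else 0))
          + 2 * α ^ 2 / n * ρ := by
          rw [Finset.sum_add_distrib, ← Finset.mul_sum, ← Finset.mul_sum, hsum, hρ]
          field_simp
      _ ≤ 2 * α ^ 2 / ((m : ℝ) * k) * (ρ + 1 / t) + 2 * α ^ 2 / ((m : ℝ) * k) * (ρ + 1 / t) := by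
          refine add_le_add (mul_le_mul_of_nonneg_left hbal.le (by positivity)) ?_
          refine mul_le_mul ?_ (by linarith [one_div_pos.2 ht]) hρ0 (by positivity)
          exact div_le_div_of_nonneg_left (by positivity) hmk hmkn
      _ = _ := by ring
  have := measure_abs_linear_ge_le c (by positivity) hV hx
  simp_rw [hlin]
  refine this.trans (le_of_eq ?_)
  congr 2
  field_simp
  norm_num

/-- Sampling deviation of the noise against itself. The three contributions are the fluctuation of
the squared noise in the bags, in the whole dataset, and that of the number of noisy indices. -/
lemma law_sampleDev_noise_noise_ge_le {m k n : ℕ} (hm : 0 < m) (hk : 0 < k) (h : m * k ≤ n)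
    (N : Finset (Fin n)) {x : ℝ} (hx : 0 < x) :
    (law m k n).real {ω | x ≤ |sampleDev ω.1 (noise N ω.2.2) (noise N ω.2.2)|}
      ≤ 6 * Real.exp (-(m * min ((x / 3) ^ 2) (x / 3) / 8)) := by
  have := isProbabilityMeasure_law h
  have hm' : (0 : ℝ) < m := by exact_mod_cast hm
  have hk' : (1 : ℝ) ≤ k := by exact_mod_cast hk
  have hk0 : (0 : ℝ) < k := by linarith
  have hmk : (0 : ℝ) < (m : ℝ) * k := by positivity
  have hmkn : (m : ℝ) * k ≤ n := by exact_mod_cast h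
  have hn : (0 : ℝ) < n := by linarith
  have hmmk : (m : ℝ) ≤ (m : ℝ) * k := le_mul_of_one_le_right hm'.le hk'
  set I : Fin n → ℝ := fun i => if i ∈ N then 1 else 0 with hI
  have hI1 : ∀ i, |I i| ≤ 1 := fun i => by simp only [hI]; split_ifs <;> simp
  set y := x / 3 with hy
  have hy0 : 0 < y := by positivity
  have hmin : 0 ≤ min (y ^ 2) y := le_min (by positivity) hy0.le
  -- a bound valid for every sample size `K ≥ m`
  have hrate : ∀ K : ℝ, (m : ℝ) ≤ K →
      2 * Real.exp (-(min ((K * y) ^ 2 / K) (K * y) / 8)) ≤ 2 * Real.exp (-(m * min (y ^ 2) y / 8)) := by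
    intro K hK
    have hK0 : 0 < K := by linarith
    refine mul_le_mul_of_nonneg_left (Real.exp_le_exp.2 (neg_le_neg ?_)) (by norm_num)
    have e1 : (K * y) ^ 2 / K = K * y ^ 2 := by field_simp
    rw [e1, ← mul_min_of_nonneg _ _ hK0.le]
    have := mul_le_mul_of_nonneg_right hK hmin
    linarith
  have h1 : (law m k n).real {ω | (m : ℝ) * k * y ≤ |∑ p, I (ω.1 p) * (ω.2.2 (ω.1 p) ^ 2 - 1)|}
      ≤ 2 * Real.exp (-(m * min (y ^ 2) y / 8)) := by
    refine law_real_le_of_bags h _ (by positivity) fun b => ?_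
    have := measure_abs_sum_sq_sub_one_ge_le b (fun p => I (b p)) (fun p => hI1 _) hmk (by simp)
      (x := (m : ℝ) * k * y) (by positivity)
    rw [← prod_real_snd_event (Measure.pi fun _ : Fin m × Fin k => gaussianReal 0 1)] at this
    exact this.trans (hrate _ hmmk)
  have h2 : (law m k n).real {ω | (n : ℝ) * y ≤ |∑ i, I i * (ω.2.2 i ^ 2 - 1)|}
      ≤ 2 * Real.exp (-(m * min (y ^ 2) y / 8)) := by
    refine law_real_le_of_bags h _ (by positivity) fun b => ?_
    have := measure_abs_sum_sq_sub_one_ge_le (Function.Embedding.refl (Fin n)) I hI1 hn (by simp)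
      (x := (n : ℝ) * y) (by positivity)
    rw [← prod_real_snd_event (Measure.pi fun _ : Fin m × Fin k => gaussianReal 0 1)] at this
    exact this.trans (hrate _ (hmmk.trans hmkn))
  have h3 : (law m k n).real {ω | ω.1 ∈ {b : Bags m k n |
      y ≤ |1 / ((m : ℝ) * k) * ∑ p, I (b p) - 1 / (n : ℝ) * ∑ i, I i|}}
      ≤ 2 * Real.exp (-(m * min (y ^ 2) y / 8)) := by
    rw [law_real_bags_event]
    refine (uniformOn_bags_abs_sum_ge_le hm hk h I one_pos hI1 hy0).trans ?_
    refine mul_le_mul_of_nonneg_left (Real.exp_le_exp.2 (neg_le_neg ?_)) (by norm_num)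
    have e1 := mul_le_mul_of_nonneg_left (min_le_left (y ^ 2) y) hm'.le
    have e2 := mul_le_mul_of_nonneg_right hmmk (sq_nonneg y)
    linarith
  refine (measureReal_mono (s₂ := ({ω | (m : ℝ) * k * y ≤ |∑ p, I (ω.1 p) * (ω.2.2 (ω.1 p) ^ 2 - 1)|} ∪
      {ω | (n : ℝ) * y ≤ |∑ i, I i * (ω.2.2 i ^ 2 - 1)|}) ∪ {ω | ω.1 ∈ {b : Bags m k n |
      y ≤ |1 / ((m : ℝ) * k) * ∑ p, I (b p) - 1 / (n : ℝ) * ∑ i, I i|}}) ?_).trans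
    ((measureReal_union_le _ _).trans ((add_le_add_left (measureReal_union_le _ _) _).trans
      (by linarith)))
  intro ω hω
  by_contra hcon
  simp only [Set.mem_union, Set.mem_ofPred_eq, not_or, not_le] at hcon hω
  obtain ⟨⟨c1, c2⟩, c3⟩ := hcon
  have hsq : ∀ i, noise N ω.2.2 i * noise N ω.2.2 i = I i * (ω.2.2 i ^ 2 - 1) + I i := by
    intro i
    simp only [noise, hI]
    split_ifs <;> ring
  have hdec : sampleDev ω.1 (noise N ω.2.2) (noise N ω.2.2)
      = 1 / ((m : ℝ) * k) * ∑ p, I (ω.1 p) * (ω.2.2 (ω.1 p) ^ 2 - 1)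
        - 1 / (n : ℝ) * ∑ i, I i * (ω.2.2 i ^ 2 - 1)
        + (1 / ((m : ℝ) * k) * ∑ p, I (ω.1 p) - 1 / (n : ℝ) * ∑ i, I i) := by
    simp_rw [sampleDev, hsq]
    rw [Finset.sum_add_distrib, Finset.sum_add_distrib]
    ring
  have d1 : |1 / ((m : ℝ) * k) * ∑ p, I (ω.1 p) * (ω.2.2 (ω.1 p) ^ 2 - 1)| < y := by
    rw [abs_mul, abs_of_pos (by positivity), one_div, ← div_eq_inv_mul, div_lt_iff₀ hmk]
    linarith
  have d2 : |1 / (n : ℝ) * ∑ i, I i * (ω.2.2 i ^ 2 - 1)| < y := by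
    rw [abs_mul, abs_of_pos (by positivity), one_div, ← div_eq_inv_mul, div_lt_iff₀ hn]
    linarith
  rw [hdec] at hω
  have := (abs_add_le _ _).trans_lt (add_lt_add ((abs_sub _ _).trans_lt (add_lt_add d1 d2)) c3)
  linarith

/-! ### Tail bounds for the deviation involving the noise -/

/-- The event on which no bag carries much noise and the bags contain few noisy indices. -/
def goodEvent {m k n : ℕ} (N : Finset (Fin n)) (t : ℝ) : Set (Randomness m k n) :=
  {ω | ω.2.2 ∈ lightNoise t ω.1 ∧ ω.1 ∈ balancedBags N t}

lemma pi_lightNoise_compl_le {m k n : ℕ} (hk : 0 < k) (b : Bags m k n) {r : ℝ} (hr : 0 ≤ r) :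
    (Measure.pi fun _ : Fin n => gaussianReal 0 1).real (lightNoise r b)ᶜ
      ≤ m * (2 * Real.exp (-(r / 2))) := by
  have hk0 : (0 : ℝ) < k := by exact_mod_cast hk
  have hcov : (lightNoise r b)ᶜ ⊆ ⋃ j : Fin m, {g | 4 * ((k : ℝ) + r) ≤ ∑ i, g (b (j, i)) ^ 2} := by
    intro g hg
    simpa [lightNoise] using hg
  have hj : ∀ j : Fin m, (Measure.pi fun _ : Fin n => gaussianReal 0 1).real
      {g | 4 * ((k : ℝ) + r) ≤ ∑ i, g (b (j, i)) ^ 2} ≤ 2 * Real.exp (-(r / 2)) := fun j =>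
    measure_sum_sq_ge_le ((Function.Embedding.sectR j (Fin k)).trans b) hk0 (by simp) hr
  refine (measureReal_mono hcov).trans ((measureReal_iUnion_fintype_le _).trans ?_)
  refine (Finset.sum_le_sum fun j _ => hj j).trans (le_of_eq ?_)
  rw [Finset.sum_const, Finset.card_univ, Fintype.card_fin, nsmul_eq_mul]

lemma uniformOn_balancedBags_compl_le {m k n : ℕ} (hm : 0 < m) (hk : 0 < k) (h : m * k ≤ n)
    (N : Finset (Fin n)) {r : ℝ} (hr : 1 ≤ r) (hrm : r ^ 4 = m) :
    (uniformOn (Set.univ : Set (Bags m k n))).real (balancedBags N r)ᶜ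
      ≤ Real.exp (-(r / 8)) := by
  have hr0 : 0 < r := by linarith
  have hk' : (1 : ℝ) ≤ k := by exact_mod_cast hk
  have h3 := uniformOn_bags_sum_ge_le hm hk h (fun i => if i ∈ N then (1 : ℝ) else 0) one_pos
    (fun i => by split_ifs <;> simp) (x := 1 / r) (by positivity)
  have hset : (balancedBags N r)ᶜ = {b : Bags m k n | 1 / r ≤ 1 / ((m : ℝ) * k) *
      ∑ p, (if b p ∈ N then (1 : ℝ) else 0) - 1 / (n : ℝ) * ∑ i, if i ∈ N then (1 : ℝ) else 0} := by
    ext b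
    have hN : ∑ i, (if i ∈ N then (1 : ℝ) else 0) = N.card := by simp
    rw [Set.mem_compl_iff, balancedBags, Set.mem_ofPred_eq, Set.mem_ofPred_eq, not_lt,
      le_sub_iff_add_le, add_comm, hN, one_div_mul_eq_div (n : ℝ)]
  rw [hset]
  refine h3.trans (Real.exp_le_exp.2 (neg_le_neg ?_))
  have e1 : (m : ℝ) * k * (1 / r) ^ 2 / (8 * 1 ^ 2) = r ^ 2 * k / 8 := by
    rw [← hrm]; field_simp
  rw [e1]
  have e2 : r ≤ r ^ 2 * k := by nlinarith
  linarith

/-- The level `r = m ^ (1 / 4)` is high enough for both parts of the good event: the tail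
`exp (-r / 2)` of the noise in one bag survives the union bound over the `m` bags, and Hoeffding's
inequality at distance `1 / r` has exponent `m k / (8 r ^ 2) ≥ r / 8`. -/
lemma law_goodEvent_compl_le {m k n : ℕ} (hm : 0 < m) (hk : 0 < k) (h : m * k ≤ n)
    (N : Finset (Fin n)) {r : ℝ} (hr : 1 ≤ r) (hrm : r ^ 4 = m) :
    (law m k n).real (goodEvent N r)ᶜ
      ≤ 2 * r ^ 4 * Real.exp (-(r / 2)) + Real.exp (-(r / 8)) := by
  have := isProbabilityMeasure_law h
  have hr0 : 0 < r := by linarith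
  have h1 : (law m k n).real {ω | ω.2.2 ∉ lightNoise r ω.1} ≤ 2 * r ^ 4 * Real.exp (-(r / 2)) := by
    refine law_real_le_of_bags h _ (by positivity) fun b => ?_
    have := pi_lightNoise_compl_le hk b hr0.le
    rw [← prod_real_snd_event (Measure.pi fun _ : Fin m × Fin k => gaussianReal 0 1), ← hrm] at this
    exact this.trans (le_of_eq (by ring))
  have h2 : (law m k n).real {ω | ω.1 ∈ (balancedBags N r)ᶜ} ≤ Real.exp (-(r / 8)) := by
    rw [law_real_bags_event]
    exact uniformOn_balancedBags_compl_le hm hk h N hr hrm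
  have hcov : (goodEvent N r)ᶜ ⊆ {ω : Randomness m k n | ω.2.2 ∉ lightNoise r ω.1} ∪
      {ω | ω.1 ∈ (balancedBags N r)ᶜ} := by
    intro ω hω
    rw [Set.mem_compl_iff, goodEvent, Set.mem_ofPred_eq, not_and_or] at hω
    exact hω
  exact (measureReal_mono hcov).trans ((measureReal_union_le _ _).trans (add_le_add h1 h2))

/-- On light noise, every bag of `k` indices carries noise of squared norm at most `8 r k`. -/
lemma sum_noise_sq_le {m k n : ℕ} (hk : 0 < k) (N : Finset (Fin n)) {r : ℝ} (hr : 1 ≤ r)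
    {b : Bags m k n} {g : Fin n → ℝ} (hg : g ∈ lightNoise r b) (j : Fin m) :
    ∑ i, noise N g (b (j, i)) ^ 2 ≤ √(8 * (r * k)) ^ 2 := by
  have hk' : (1 : ℝ) ≤ k := by exact_mod_cast hk
  rw [Real.sq_sqrt (by positivity)]
  refine (Finset.sum_le_sum fun i _ => noise_sq_le N g _).trans ((hg j).le.trans ?_)
  nlinarith

/-- Deviation of a bounded vector against the noise. -/
lemma law_dev_noise_ge_le {m k n : ℕ} (hm : 0 < m) (hk : 0 < k) (h : m * k ≤ n)
    {N : Finset (Fin n)} (hN : N.Nonempty) {r : ℝ} (hr : 1 ≤ r) (hrm : r ^ 4 = m) {u : Fin n → ℝ}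
    {α : ℝ} (hα : 0 < α) (hu : ∀ i, |u i| ≤ α) {x : ℝ} (hx : 0 < x) :
    (law m k n).real {ω | ω ∈ goodEvent N r ∧ x ≤ |dev ω.1 ω.2.1 u (noise N ω.2.2)|}
      ≤ 6 * Real.exp (-(min (r ^ 2 * min ((x / α) ^ 2) (x / α))
          (m * k * (x / α) ^ 2 / ((N.card : ℝ) / n)) / 1152)) := by
  have := isProbabilityMeasure_law h
  have hr0 : 0 < r := by linarith
  have hm' : (0 : ℝ) < m := by exact_mod_cast hm
  have hk' : (1 : ℝ) ≤ k := by exact_mod_cast hk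
  have hk0 : (0 : ℝ) < k := by linarith
  have hn0 : (0 : ℝ) < n := by
    have : (m : ℝ) * k ≤ n := by exact_mod_cast h
    exact lt_of_lt_of_le (by positivity) this
  have hNc : (0 : ℝ) < N.card := by exact_mod_cast hN.card_pos
  set ρ := (N.card : ℝ) / n with hρ
  have hρ0 : 0 < ρ := by positivity
  set τ := x / α with hτ
  have hτ0 : 0 < τ := by positivity
  set E := min (r ^ 2 * min (τ ^ 2) τ) (m * k * τ ^ 2 / ρ) with hE
  have hE1 : E ≤ r ^ 2 * τ ^ 2 := (min_le_left _ _).trans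
    (mul_le_mul_of_nonneg_left (min_le_left _ _) (by positivity))
  have hE2 : E ≤ r ^ 2 * τ := (min_le_left _ _).trans
    (mul_le_mul_of_nonneg_left (min_le_right _ _) (by positivity))
  have hE3 : E ≤ m * k * τ ^ 2 / ρ := min_le_right _ _
  have hE0 : 0 ≤ E := le_min (mul_nonneg (by positivity) (le_min (by positivity) hτ0.le))
    (by positivity)
  -- `3 r √k` is a simple upper bound for the bag norm `√(8 r k)` of light noise
  have h1 := law_weightDev_ge_le hm hk h (u := fun _ => u) (v := noise N) measurable_const
    (measurable_noise N) (G := lightNoise r) (measurableSet_lightNoise r)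
    (p := √(k : ℝ) * α) (q := 3 * r * √(k : ℝ)) (by positivity) (by positivity)
    (fun b _ _ j => by
      rw [mul_pow, Real.sq_sqrt hk0.le]
      refine (Finset.sum_le_sum fun r _ => (sq_abs (u (b (j, r)))).symm.le.trans
        (pow_le_pow_left₀ (abs_nonneg _) (hu _) 2)).trans ?_
      simp)
    (fun b g hg j => by
      refine (sum_noise_sq_le hk N hr hg j).trans ?_
      rw [Real.sq_sqrt (by positivity), mul_pow, Real.sq_sqrt hk0.le]
      have : r * k ≤ r ^ 2 * k := by nlinarith [mul_pos hr0 hk0]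
      nlinarith) (x := x / 2) (by positivity)
  have h2 := law_sampleDev_noise_ge_le hm hk h N hα hr0 hu (x := x / 2) (by positivity)
  have hpq : √(k : ℝ) * α * (3 * r * √(k : ℝ)) = 3 * r * k * α := by
    calc _ = √(k : ℝ) * √(k : ℝ) * (3 * r * α) := by ring
      _ = _ := by rw [Real.mul_self_sqrt hk0.le]; ring
  have e1 : 4 * Real.exp (-(min (((m : ℝ) * k * (x / 2)) ^ 2 /
        (m * (√(k : ℝ) * α * (3 * r * √(k : ℝ))) ^ 2))
        ((m : ℝ) * k * (x / 2) / (√(k : ℝ) * α * (3 * r * √(k : ℝ)))) / 32))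
      ≤ 4 * Real.exp (-(E / 1152)) := by
    refine mul_le_mul_of_nonneg_left (Real.exp_le_exp.2 (neg_le_neg ?_)) (by norm_num)
    rw [hpq]
    have e3 : ((m : ℝ) * k * (x / 2)) ^ 2 / (m * (3 * r * k * α) ^ 2) = r ^ 2 * τ ^ 2 / 36 := by
      rw [hτ, ← hrm]; field_simp; norm_num
    have e4 : (m : ℝ) * k * (x / 2) / (3 * r * k * α) = r ^ 3 * τ / 6 := by
      rw [hτ, ← hrm]; field_simp; norm_num
    rw [e3, e4]
    have e5 : r ^ 2 * τ ≤ r ^ 3 * τ := by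
      refine mul_le_mul_of_nonneg_right (pow_le_pow_right₀ hr (by norm_num)) hτ0.le
    have e6 : E / 36 ≤ min (r ^ 2 * τ ^ 2 / 36) (r ^ 3 * τ / 6) := le_min (by linarith) (by linarith)
    linarith
  have e2 : 2 * Real.exp (-(m * k * (x / 2 / α) ^ 2 / (8 * (ρ + 1 / r))))
      ≤ 2 * Real.exp (-(E / 1152)) := by
    refine mul_le_mul_of_nonneg_left (Real.exp_le_exp.2 (neg_le_neg ?_)) (by norm_num)
    have e3 : x / 2 / α = τ / 2 := by rw [hτ]; ring
    rw [e3, le_div_iff₀ (by positivity)]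
    -- the excess `1 / r` of noisy indices in balanced bags costs nothing beyond the rate
    -- `r ^ 2 τ ^ 2`, which is already present
    have e4 : E * ρ ≤ m * k * τ ^ 2 := by rwa [le_div_iff₀ hρ0] at hE3
    have e5 : E * (1 / r) ≤ m * k * τ ^ 2 := by
      calc E * (1 / r) ≤ E * 1 :=
            mul_le_mul_of_nonneg_left (by rw [div_le_one hr0]; exact hr) hE0
        _ ≤ r ^ 2 * τ ^ 2 := by linarith
        _ ≤ r ^ 4 * τ ^ 2 := mul_le_mul_of_nonneg_right
            (pow_le_pow_right₀ hr (by norm_num)) (by positivity)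
        _ ≤ m * k * τ ^ 2 := by
            rw [hrm]
            exact mul_le_mul_of_nonneg_right (le_mul_of_one_le_right hm'.le hk') (by positivity)
    nlinarith
  refine (measureReal_mono (s₂ := {ω | ω.2.2 ∈ lightNoise r ω.1 ∧
      x / 2 ≤ |weightDev ω.1 ω.2.1 u (noise N ω.2.2)|} ∪ {ω | ω.1 ∈ balancedBags N r ∧
        x / 2 ≤ |sampleDev ω.1 u (noise N ω.2.2)|}) ?_).trans
    ((measureReal_union_le _ _).trans (by linarith))
  rintro ω ⟨hg, hω⟩
  rw [dev_eq_add] at hω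
  by_contra hcon
  simp only [Set.mem_union, Set.mem_ofPred_eq, hg.1, hg.2, true_and, not_or, not_le] at hcon
  have := (abs_add_le _ _).trans_lt (add_lt_add hcon.1 hcon.2)
  linarith

/-- Deviation of the noise against itself. -/
lemma law_dev_noise_noise_ge_le {m k n : ℕ} (hm : 0 < m) (hk : 0 < k) (h : m * k ≤ n)
    (N : Finset (Fin n)) {r : ℝ} (hr : 1 ≤ r) (hrm : r ^ 4 = m) {x : ℝ} (hx : 0 < x) :
    (law m k n).real
        {ω | ω ∈ goodEvent N r ∧ x ≤ |dev ω.1 ω.2.1 (noise N ω.2.2) (noise N ω.2.2)|}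
      ≤ 10 * Real.exp (-(min (r ^ 2 * x ^ 2) r / 8192)) := by
  have := isProbabilityMeasure_law h
  have hr0 : 0 < r := by linarith
  have hm' : (0 : ℝ) < m := by exact_mod_cast hm
  have hk' : (1 : ℝ) ≤ k := by exact_mod_cast hk
  have hk0 : (0 : ℝ) < k := by linarith
  set E := min (r ^ 2 * x ^ 2) r with hE
  have hE0 : 0 ≤ E := le_min (by positivity) hr0.le
  have hE2 : E ≤ r ^ 2 * x ^ 2 := min_le_left _ _
  have hEx : E ≤ r ^ 2 * x := by
    rcases le_total x 1 with hx1 | hx1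
    · exact hE2.trans (mul_le_mul_of_nonneg_left (by nlinarith) (by positivity))
    · exact (min_le_right _ _).trans (by nlinarith)
  have h1 := law_weightDev_ge_le hm hk h (u := noise N) (v := noise N) (measurable_noise N)
    (measurable_noise N) (G := lightNoise r) (measurableSet_lightNoise r)
    (p := √(8 * (r * k))) (q := √(8 * (r * k))) (by positivity) (by positivity)
    (fun b g hg j => sum_noise_sq_le hk N hr hg j)
    (fun b g hg j => sum_noise_sq_le hk N hr hg j) (x := x / 2) (by positivity)
  have h2 := law_sampleDev_noise_noise_ge_le hm hk h N (x := x / 2) (by positivity)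
  rw [Real.mul_self_sqrt (by positivity)] at h1
  have e1 : 4 * Real.exp (-(min (((m : ℝ) * k * (x / 2)) ^ 2 / (m * (8 * (r * k)) ^ 2))
        ((m : ℝ) * k * (x / 2) / (8 * (r * k))) / 32)) ≤ 4 * Real.exp (-(E / 8192)) := by
    refine mul_le_mul_of_nonneg_left (Real.exp_le_exp.2 (neg_le_neg ?_)) (by norm_num)
    have e3 : ((m : ℝ) * k * (x / 2)) ^ 2 / (m * (8 * (r * k)) ^ 2) = r ^ 2 * x ^ 2 / 256 := by
      rw [← hrm]; field_simp; norm_num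
    have e4 : (m : ℝ) * k * (x / 2) / (8 * (r * k)) = r ^ 3 * x / 16 := by
      rw [← hrm]; field_simp; norm_num
    rw [e3, e4]
    have e5 : r ^ 2 * x ≤ r ^ 3 * x :=
      mul_le_mul_of_nonneg_right (pow_le_pow_right₀ hr (by norm_num)) hx.le
    have e6 : E / 256 ≤ min (r ^ 2 * x ^ 2 / 256) (r ^ 3 * x / 16) := le_min (by linarith) (by linarith)
    linarith
  have e2 : 6 * Real.exp (-(m * min ((x / 2 / 3) ^ 2) (x / 2 / 3) / 8))
      ≤ 6 * Real.exp (-(E / 8192)) := by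
    refine mul_le_mul_of_nonneg_left (Real.exp_le_exp.2 (neg_le_neg ?_)) (by norm_num)
    have e5 : r ^ 2 ≤ m := by rw [← hrm]; exact pow_le_pow_right₀ hr (by norm_num)
    have e6 : E / 36 ≤ m * min ((x / 2 / 3) ^ 2) (x / 2 / 3) := by
      rw [mul_min_of_nonneg _ _ hm'.le]
      refine le_min ?_ ?_
      · have := mul_le_mul_of_nonneg_right e5 (sq_nonneg x)
        nlinarith
      · have := mul_le_mul_of_nonneg_right e5 hx.le
        nlinarith
    linarith
  refine (measureReal_mono (s₂ := {ω | ω.2.2 ∈ lightNoise r ω.1 ∧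
      x / 2 ≤ |weightDev ω.1 ω.2.1 (noise N ω.2.2) (noise N ω.2.2)|} ∪ {ω |
        x / 2 ≤ |sampleDev ω.1 (noise N ω.2.2) (noise N ω.2.2)|}) ?_).trans
    ((measureReal_union_le _ _).trans (by linarith))
  rintro ω ⟨hg, hω⟩
  rw [dev_eq_add] at hω
  by_contra hcon
  simp only [Set.mem_union, Set.mem_ofPred_eq, hg.1, true_and, not_or, not_le] at hcon
  have := (abs_add_le _ _).trans_lt (add_lt_add hcon.1 hcon.2)
  linarith

/-! ### Nets in a ball -/

/-- Volume bound for separated sets: an `ε`-separated subset of a ball of radius `R` in `ℝ^d` has at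
most `(1 + 2 R / ε) ^ d` elements. -/
lemma card_le_of_separated_of_norm_le {d : ℕ} {R ε : ℝ} (hR : 0 ≤ R) (hε : 0 < ε)
    (A : Finset (EuclideanSpace ℝ (Fin d))) (hA : ∀ a ∈ A, ‖a‖ ≤ R)
    (hsep : ∀ a ∈ A, ∀ b ∈ A, a ≠ b → ε ≤ ‖a - b‖) : (A.card : ℝ) ≤ (1 + 2 * R / ε) ^ d := by
  have hδ : 0 < ε / 2 := by positivity
  have hρ : 0 < R + ε / 2 := by positivity
  have hdisj : (A : Set (EuclideanSpace ℝ (Fin d))).PairwiseDisjoint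
      (fun a => Metric.ball a (ε / 2)) := by
    intro a ha b hb hab
    apply Metric.ball_disjoint_ball
    rw [dist_eq_norm]
    linarith [hsep a ha b hb hab]
  have hsub : (⋃ a ∈ A, Metric.ball a (ε / 2)) ⊆ Metric.ball 0 (R + ε / 2) := by
    refine Set.iUnion₂_subset fun a ha => Metric.ball_subset_ball' ?_
    rw [dist_zero_right]
    linarith [hA a ha]
  have hvol := measure_mono (μ := (volume : Measure (EuclideanSpace ℝ (Fin d)))) hsub
  rw [measure_biUnion_finset hdisj fun a _ => measurableSet_ball] at hvol
  simp only [Measure.addHaar_ball_of_pos _ _ hδ, Measure.addHaar_ball_of_pos _ _ hρ,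
    Finset.sum_const, nsmul_eq_mul, ← mul_assoc, finrank_euclideanSpace, Fintype.card_fin] at hvol
  have h1 : (A.card : ENNReal) * ENNReal.ofReal ((ε / 2) ^ d) ≤ ENNReal.ofReal ((R + ε / 2) ^ d) :=
    (ENNReal.mul_le_mul_iff_left (Metric.measure_ball_pos _ _ zero_lt_one).ne'
      measure_ball_lt_top.ne).1 hvol
  have h2 : (A.card : ℝ) * (ε / 2) ^ d ≤ (R + ε / 2) ^ d := by
    have := ENNReal.toReal_le_of_le_ofReal (by positivity) h1
    rwa [ENNReal.toReal_mul, ENNReal.toReal_natCast, ENNReal.toReal_ofReal (by positivity)] at this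
  have h3 : (1 + 2 * R / ε) ^ d = (R + ε / 2) ^ d / (ε / 2) ^ d := by
    rw [← div_pow]
    congr 1
    field_simp
    ring
  rw [h3, le_div_iff₀ (by positivity)]
  exact h2

/-- Every bounded set of `ℝ^d` contains a finite net of controlled size: a separated subset that
cannot be enlarged. -/
lemma exists_finset_net {d : ℕ} (P : Set (EuclideanSpace ℝ (Fin d))) {R ε : ℝ} (hR : 0 ≤ R)
    (hε : 0 < ε) (hP : ∀ s ∈ P, ‖s‖ ≤ R) :
    ∃ A : Finset (EuclideanSpace ℝ (Fin d)), (∀ a ∈ A, a ∈ P) ∧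
      (∀ s ∈ P, ∃ a ∈ A, ‖s - a‖ < ε) ∧ (A.card : ℝ) ≤ (1 + 2 * R / ε) ^ d := by
  classical
  by_contra! hcon
  have hgrow : ∀ c : ℕ, ∃ A : Finset (EuclideanSpace ℝ (Fin d)), A.card = c ∧ (∀ a ∈ A, a ∈ P) ∧
      ∀ a ∈ A, ∀ b ∈ A, a ≠ b → ε ≤ ‖a - b‖ := by
    intro c
    induction c with
    | zero => exact ⟨∅, by simp⟩
    | succ c ih =>
      obtain ⟨A, hc, hAP, hsep⟩ := ih
      have : ∃ s ∈ P, ∀ a ∈ A, ε ≤ ‖s - a‖ := by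
        by_contra! hno
        exact absurd (card_le_of_separated_of_norm_le hR hε A (fun a ha => hP a (hAP a ha)) hsep)
          (not_le.2 (hcon A hAP hno))
      obtain ⟨s, hs, hsA⟩ := this
      have hsn : s ∉ A := fun h => by
        have := hsA s h
        simp only [sub_self, norm_zero] at this
        linarith
      refine ⟨insert s A, by rw [Finset.card_insert_of_notMem hsn, hc], ?_, ?_⟩
      · intro a ha
        rcases Finset.mem_insert.1 ha with rfl | ha
        · exact hs
        · exact hAP a ha
      · intro a ha b hb hab
        rw [Finset.mem_insert] at ha hb
        rcases ha with ha | ha <;> rcases hb with hb | hb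
        · exact absurd (ha.trans hb.symm) hab
        · rw [ha]; exact hsA b hb
        · rw [hb, norm_sub_rev]; exact hsA a ha
        · exact hsep a ha b hb hab
  obtain ⟨c, hc⟩ := exists_nat_gt ((1 + 2 * R / ε) ^ d)
  obtain ⟨A, hAc, hAP, hsep⟩ := hgrow c
  have := card_le_of_separated_of_norm_le hR hε A (fun a ha => hP a (hAP a ha)) hsep
  rw [hAc] at this
  linarith

/-- Nets at scale `δ` with respect to the `L`-fold distance; for `L = 0` one point suffices. -/
lemma exists_finset_net_mul {d : ℕ} (P : Set (EuclideanSpace ℝ (Fin d))) {L R δ : ℝ} (hL : 0 ≤ L)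
    (hR : 0 ≤ R) (hδ : 0 < δ) (hP : ∀ s ∈ P, ‖s‖ ≤ R) :
    ∃ A : Finset (EuclideanSpace ℝ (Fin d)), (∀ a ∈ A, a ∈ P) ∧
      (∀ s ∈ P, ∃ a ∈ A, L * ‖s - a‖ ≤ δ) ∧ (A.card : ℝ) ≤ (1 + 2 * (L * R) / δ) ^ d := by
  rcases hL.eq_or_lt with rfl | hL
  · rcases P.eq_empty_or_nonempty with rfl | ⟨s₀, hs₀⟩
    · exact ⟨∅, by simp, by simp, by simp⟩
    · exact ⟨{s₀}, by simpa using hs₀, fun s _ => ⟨s₀, by simp, by simpa using hδ.le⟩, by simp⟩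
  · obtain ⟨A, hAP, hnet, hcard⟩ := exists_finset_net P hR (div_pos hδ hL) hP
    refine ⟨A, hAP, fun s hs => ?_, hcard.trans (le_of_eq ?_)⟩
    · obtain ⟨a, ha, hsa⟩ := hnet s hs
      refine ⟨a, ha, ?_⟩
      rw [lt_div_iff₀ hL] at hsa
      linarith
    · congr 2
      field_simp

/-! ### Chaining -/

lemma dev_comm {m k n : ℕ} (b : Bags m k n) (w : Fin m × Fin k → ℝ) (u v : Fin n → ℝ) :
    dev b w u v = dev b w v u := by
  simp only [dev, mul_comm]

lemma dev_add_left {m k n : ℕ} (b : Bags m k n) (w : Fin m × Fin k → ℝ) (u u' v : Fin n → ℝ) :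
    dev b w (u + u') v = dev b w u v + dev b w u' v := by
  simp only [dev, Pi.add_apply, mul_add, add_mul, Finset.sum_add_distrib]
  ring

lemma dev_sub_left {m k n : ℕ} (b : Bags m k n) (w : Fin m × Fin k → ℝ) (u u' v : Fin n → ℝ) :
    dev b w (u - u') v = dev b w u v - dev b w u' v := by
  have := dev_add_left b w (u - u') u' v
  rw [sub_add_cancel] at this
  linarith

lemma dev_add_right {m k n : ℕ} (b : Bags m k n) (w : Fin m × Fin k → ℝ) (u v v' : Fin n → ℝ) :
    dev b w u (v + v') = dev b w u v + dev b w u v' := by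
  rw [dev_comm, dev_add_left, dev_comm b w v, dev_comm b w v']

lemma continuous_dev_self_add {m k n : ℕ} (b : Bags m k n) (w : Fin m × Fin k → ℝ)
    (v : Fin n → ℝ) : Continuous fun u => dev b w u u + 2 * dev b w u v := by
  unfold dev
  fun_prop

/-- The chaining bound. Along a sequence that approximates `x`, the increments of
`u ↦ dev u u + 2 dev u v` are values of `dev` at differences, and their bounds sum up. -/
lemma abs_dev_self_add_le_of_chain {m k n : ℕ} (b : Bags m k n) (w : Fin m × Fin k → ℝ)
    (v x : Fin n → ℝ) (c : ℕ → Fin n → ℝ) (hc : Filter.Tendsto c Filter.atTop (nhds x)) {θ : ℝ}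
    (h0 : |dev b w (c 0) (c 0)| ≤ θ ∧ |dev b w (c 0) v| ≤ θ)
    (hs : ∀ l, |dev b w (c (l + 1) - c l) (c (l + 1) + c l)| ≤ θ / 2 ^ (l + 1) ∧
      |dev b w (c (l + 1) - c l) v| ≤ θ / 2 ^ (l + 1)) :
    |dev b w x x + 2 * dev b w x v| ≤ 6 * θ := by
  have hθ : 0 ≤ θ := (abs_nonneg _).trans h0.1
  have hind : ∀ l, |dev b w (c l) (c l) + 2 * dev b w (c l) v| ≤ 3 * (θ * (2 - 1 / 2 ^ l)) := by
    intro l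
    induction l with
    | zero =>
      refine (abs_add_le _ _).trans ?_
      rw [abs_mul, abs_two]
      norm_num
      linarith [h0.1, h0.2]
    | succ l ih =>
      have e : dev b w (c (l + 1)) (c (l + 1)) + 2 * dev b w (c (l + 1)) v
          = (dev b w (c l) (c l) + 2 * dev b w (c l) v)
            + (dev b w (c (l + 1) - c l) (c (l + 1) + c l)
              + 2 * dev b w (c (l + 1) - c l) v) := by
        rw [dev_add_right, dev_sub_left, dev_sub_left, dev_sub_left, dev_comm b w (c l) (c (l + 1))]
        ring
      rw [e]
      refine (abs_add_le _ _).trans ((add_le_add ih ((abs_add_le _ _).trans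
        (add_le_add (hs l).1 (le_of_eq (abs_mul _ _))))).trans ?_)
      rw [abs_two]
      have h2 := (hs l).2
      have h3 : θ * (1 / 2 ^ l) = 2 * (θ / 2 ^ (l + 1)) := by rw [pow_succ]; field_simp
      have h4 : ∀ j, 3 * (θ * (2 - 1 / 2 ^ j)) = 6 * θ - 3 * (θ * (1 / 2 ^ j)) := fun j => by ring
      have h5 : θ * (1 / 2 ^ (l + 1)) = θ / 2 ^ (l + 1) := by ring
      rw [h4, h4]
      linarith
  have hlim := ((continuous_dev_self_add b w v).tendsto x).comp hc
  refine le_of_tendsto hlim.abs (Filter.Eventually.of_forall fun l => (hind l).trans ?_)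
  have : 0 ≤ θ * (1 / 2 ^ l) := by positivity
  rw [mul_sub]
  linarith

/-- Chaining over a Lipschitz family `a` of vectors with entries bounded by `σ`. The set `U l`
consists of the pairs of the difference and the sum of neighbouring points of the nets at the scales
`σ / 4 ^ l` and `σ / 4 ^ (l - 1)`. Small deviations on all the `U l` imply small deviations on the
whole family. -/
lemma exists_chain {d n : ℕ} (P : Set (EuclideanSpace ℝ (Fin d)))
    (a : EuclideanSpace ℝ (Fin d) → Fin n → ℝ) {L R σ : ℝ} (hL : 0 ≤ L) (hR : 0 ≤ R) (hσ : 0 < σ)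
    (hP : ∀ s ∈ P, ‖s‖ ≤ R) (hlip : ∀ s ∈ P, ∀ t ∈ P, ∀ i, |a s i - a t i| ≤ L * ‖s - t‖)
    (hbd : ∀ s ∈ P, ∀ i, |a s i| ≤ σ) :
    ∃ U : ℕ → Finset ((Fin n → ℝ) × (Fin n → ℝ)),
      (∀ l, ((U l).card : ℝ) ≤ ((1 + 2 * (L * R) / σ) * 4 ^ l) ^ (2 * d)) ∧
      (∀ l, ∀ x ∈ U l, (∀ i, |x.1 i| ≤ 8 * σ / 4 ^ l) ∧ ∀ i, |x.2 i| ≤ 2 * σ) ∧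
      ∀ {m k : ℕ} (b : Bags m k n) (w : Fin m × Fin k → ℝ) (v : Fin n → ℝ) (θ : ℝ),
        (∀ l, ∀ x ∈ U l, |dev b w x.1 x.2| ≤ θ / 2 ^ l ∧ |dev b w x.1 v| ≤ θ / 2 ^ l) →
        ∀ s ∈ P, |dev b w (a s) (a s) + 2 * dev b w (a s) v| ≤ 6 * θ := by
  classical
  have hnet := fun l : ℕ => exists_finset_net_mul P hL hR (δ := σ / 4 ^ l) (by positivity) hP
  choose A hAP hAnet hAcard using hnet
  set D := 1 + 2 * (L * R) / σ with hD
  have hD1 : 1 ≤ D := by rw [hD]; linarith [show 0 ≤ 2 * (L * R) / σ by positivity]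
  have hD0 : 0 < D := by linarith
  have hcard : ∀ l, ((A l).card : ℝ) ≤ (D * 4 ^ l) ^ d := by
    intro l
    refine (hAcard l).trans (pow_le_pow_left₀ (by positivity) ?_ d)
    have h4 : (1 : ℝ) ≤ 4 ^ l := one_le_pow₀ (by norm_num)
    have : 2 * (L * R) / (σ / 4 ^ l) = 2 * (L * R) / σ * 4 ^ l := by field_simp
    rw [this, hD]
    linarith
  refine ⟨fun l => match l with
    | 0 => (A 0).image fun p => (a p, a p)
    | l + 1 => ((A (l + 1) ×ˢ A l).filter fun x => ∀ i, |a x.1 i - a x.2 i| ≤ 2 * σ / 4 ^ l).image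
        fun x => (a x.1 - a x.2, a x.1 + a x.2), ?_, ?_, ?_⟩
  · rintro (_ | l)
    · have h1 : (((A 0).image fun p => (a p, a p)).card : ℝ) ≤ (A 0).card := by
        exact_mod_cast Finset.card_image_le
      refine h1.trans ((hcard 0).trans ?_)
      exact pow_le_pow_right₀ (by simpa using hD1) (by omega)
    · have h1 : ((((A (l + 1) ×ˢ A l).filter fun x => ∀ i, |a x.1 i - a x.2 i| ≤ 2 * σ / 4 ^ l).image
          fun x => (a x.1 - a x.2, a x.1 + a x.2)).card : ℝ)
          ≤ (A (l + 1)).card * (A l).card := by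
        rw [← Nat.cast_mul, ← Finset.card_product]
        exact_mod_cast Finset.card_image_le.trans (Finset.card_filter_le _ _)
      refine h1.trans ?_
      have h2 : (D * 4 ^ l) ^ d ≤ (D * 4 ^ (l + 1)) ^ d := by
        refine pow_le_pow_left₀ (by positivity) (mul_le_mul_of_nonneg_left ?_ hD0.le) d
        exact pow_le_pow_right₀ (by norm_num) (by omega)
      rw [two_mul, pow_add]
      exact mul_le_mul (hcard (l + 1)) ((hcard l).trans h2) (Nat.cast_nonneg _) (by positivity)
  · rintro (_ | l) x hx
    · obtain ⟨p, hp, rfl⟩ := Finset.mem_image.1 hx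
      have := hbd p (hAP 0 p hp)
      refine ⟨fun i => (this i).trans ?_, fun i => (this i).trans (by linarith)⟩
      norm_num
      linarith
    · obtain ⟨⟨p, q⟩, hpq, rfl⟩ := Finset.mem_image.1 hx
      obtain ⟨hmem, hclose⟩ := Finset.mem_filter.1 hpq
      obtain ⟨hp, hq⟩ := Finset.mem_product.1 hmem
      refine ⟨fun i => (hclose i).trans (le_of_eq ?_), fun i => ?_⟩
      · rw [pow_succ]; field_simp; norm_num
      · exact (abs_add_le _ _).trans
          (by linarith [hbd p (hAP _ p hp) i, hbd q (hAP _ q hq) i])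
  · intro m k b w v θ hU s hs
    choose π hπ hπs using fun l => hAnet l s hs
    have hπP := fun l => hAP l _ (hπ l)
    have hdist : ∀ l i, |a s i - a (π l) i| ≤ σ / 4 ^ l := fun l i =>
      (hlip s hs _ (hπP l) i).trans (hπs l)
    refine abs_dev_self_add_le_of_chain b w v (a s) (fun l => a (π l)) ?_ ?_ ?_
    · rw [tendsto_pi_nhds]
      intro i
      rw [tendsto_iff_dist_tendsto_zero]
      refine squeeze_zero (fun l => dist_nonneg) (fun l => ?_)
        (by simpa using (tendsto_pow_atTop_nhds_zero_of_lt_one (by norm_num : (0 : ℝ) ≤ 1 / 4)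
          (by norm_num)).const_mul σ)
      rw [dist_comm, Real.dist_eq]
      refine (hdist l i).trans (le_of_eq ?_)
      ring
    · have := hU 0 (a (π 0), a (π 0)) (Finset.mem_image.2 ⟨π 0, hπ 0, rfl⟩)
      simpa using this
    · intro l
      refine hU (l + 1) (a (π (l + 1)) - a (π l), a (π (l + 1)) + a (π l))
        (Finset.mem_image.2 ⟨(π (l + 1), π l), Finset.mem_filter.2 ⟨Finset.mem_product.2
          ⟨hπ (l + 1), hπ l⟩, fun i => ?_⟩, rfl⟩)
      have e : a (π (l + 1)) i - a (π l) i
          = (a s i - a (π l) i) - (a s i - a (π (l + 1)) i) := by ring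
      change |a (π (l + 1)) i - a (π l) i| ≤ _
      rw [e]
      refine (abs_sub _ _).trans ((add_le_add (hdist l i) (hdist (l + 1) i)).trans ?_)
      have : σ / 4 ^ (l + 1) ≤ σ / 4 ^ l :=
        div_le_div_of_nonneg_left hσ.le (by positivity) (pow_le_pow_right₀ (by norm_num) (by omega))
      calc σ / 4 ^ l + σ / 4 ^ (l + 1) ≤ σ / 4 ^ l + σ / 4 ^ l := by linarith
        _ = _ := by ring

/-! ### The union bound along the chain -/

/-- Scaling by `z ≥ 1` multiplies the rate `min (y ^ 2) y` of a sub-exponential tail at least by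
`z`, up to the loss of the constant `c ^ 2`. -/
lemma mul_min_sq_div_le {y z c : ℝ} (hy : 0 ≤ y) (hz : 1 ≤ z) (hc : 1 ≤ c) :
    z * min (y ^ 2) y / c ^ 2 ≤ min ((y * z / c) ^ 2) (y * z / c) := by
  have hc0 : 0 < c := by linarith
  have hz0 : 0 ≤ z := by linarith
  refine le_min ?_ ?_
  · rw [div_pow]
    refine div_le_div_of_nonneg_right ?_ (by positivity)
    have h1 := mul_le_mul_of_nonneg_left (min_le_left (y ^ 2) y) hz0
    have h2 : z * y ^ 2 ≤ z ^ 2 * y ^ 2 := mul_le_mul_of_nonneg_right (by nlinarith) (sq_nonneg y)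
    linarith [mul_pow y z 2]
  · rw [div_le_div_iff₀ (by positivity) hc0]
    have h1 := mul_le_mul_of_nonneg_left (min_le_right (y ^ 2) y) hz0
    have h2 : z * min (y ^ 2) y * c ≤ y * z * c := mul_le_mul_of_nonneg_right (by linarith) hc0.le
    have h3 : y * z * c ≤ y * z * c ^ 2 := mul_le_mul_of_nonneg_left (by nlinarith) (by positivity)
    linarith

/-- The exponential rate at which a family of residuals of relative size `P`, in the quadratic terms,
and `Q`, in the cross terms with the noise, concentrates. -/
noncomputable def chainRate (m k : ℕ) (r ρ P Q : ℝ) : ℝ :=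
  min (m * min (P ^ 2) P) (min (r ^ 2 * min (Q ^ 2) Q) (m * k * Q ^ 2 / ρ))

/-- Union bound over one level of the chain. The deviation allowed at level `l` decays only like
`2 ^ (-l)` while the vectors decay like `4 ^ (-l)`, which multiplies the rate by `2 ^ l`. -/
lemma law_chain_level_le {m k n d : ℕ} (hm : 0 < m) (hk : 0 < k) (h : m * k ≤ n)
    {N : Finset (Fin n)} (hN : N.Nonempty) {r : ℝ} (hr : 1 ≤ r) (hrm : r ^ 4 = m) {σ θ D : ℝ}
    (hσ : 0 < σ) (hθ : 0 < θ) (l : ℕ) (U : Finset ((Fin n → ℝ) × (Fin n → ℝ)))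
    (hcard : (U.card : ℝ) ≤ (D * 4 ^ l) ^ (2 * d))
    (hU : ∀ x ∈ U, (∀ i, |x.1 i| ≤ 8 * σ / 4 ^ l) ∧ ∀ i, |x.2 i| ≤ 2 * σ) :
    (law m k n).real {ω | ω ∈ goodEvent N r ∧ ∃ x ∈ U, ¬ (|dev ω.1 ω.2.1 x.1 x.2| ≤ θ / 2 ^ l ∧
        |dev ω.1 ω.2.1 x.1 (noise N ω.2.2)| ≤ θ / 2 ^ l)}
      ≤ (D * 4 ^ l) ^ (2 * d) * (12 * Real.exp (-(2 ^ l *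
          (chainRate m k r ((N.card : ℝ) / n) (θ / σ ^ 2) (θ / σ) / 131072)))) := by
  have := isProbabilityMeasure_law h
  have hm' : (0 : ℝ) < m := by exact_mod_cast hm
  have hk' : (0 : ℝ) < k := by exact_mod_cast hk
  have h2l : (1 : ℝ) ≤ 2 ^ l := one_le_pow₀ (by norm_num)
  have h4l : (4 : ℝ) ^ l = 2 ^ l * 2 ^ l := by rw [← mul_pow]; norm_num
  set z : ℝ := 2 ^ l with hz
  have hz0 : 0 < z := by positivity
  set P := θ / σ ^ 2 with hP
  set Q := θ / σ with hQ
  have hP0 : 0 < P := by positivity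
  have hQ0 : 0 < Q := by positivity
  set ρ := (N.card : ℝ) / n with hρ
  have hρ0 : 0 ≤ ρ := by positivity
  set E := chainRate m k r ρ P Q with hE
  have hE0 : 0 ≤ E := le_min (mul_nonneg hm'.le (le_min (by positivity) hP0.le))
    (le_min (mul_nonneg (by positivity) (le_min (by positivity) hQ0.le)) (by positivity))
  have hE1 : E ≤ m * min (P ^ 2) P := min_le_left _ _
  have hE2 : E ≤ r ^ 2 * min (Q ^ 2) Q := (min_le_right _ _).trans (min_le_left _ _)
  have hE3 : E ≤ m * k * Q ^ 2 / ρ := (min_le_right _ _).trans (min_le_right _ _)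
  have hx : ∀ x ∈ U, (law m k n).real {ω | ω ∈ goodEvent N r ∧
      ¬ (|dev ω.1 ω.2.1 x.1 x.2| ≤ θ / z ∧ |dev ω.1 ω.2.1 x.1 (noise N ω.2.2)| ≤ θ / z)}
      ≤ 12 * Real.exp (-(z * (E / 131072))) := by
    intro x hx
    have h1 := law_dev_ge_le hm hk h (α := 8 * σ / 4 ^ l) (β := 2 * σ) (by positivity)
      (by positivity) (hU x hx).1 (hU x hx).2 (x := θ / z) (by positivity)
    have h2 := law_dev_noise_ge_le hm hk h hN hr hrm (α := 8 * σ / 4 ^ l) (by positivity)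
      (hU x hx).1 (x := θ / z) (by positivity)
    have t1 : θ / z / (8 * σ / 4 ^ l * (2 * σ)) = P * z / 16 := by
      rw [h4l, hP]; field_simp; norm_num
    have t2 : θ / z / (8 * σ / 4 ^ l) = Q * z / 8 := by
      rw [h4l, hQ]; field_simp
    rw [t1] at h1
    rw [t2, ← hρ] at h2
    have e1 : 6 * Real.exp (-(m * min ((P * z / 16) ^ 2) (P * z / 16) / 128))
        ≤ 6 * Real.exp (-(z * (E / 131072))) := by
      refine mul_le_mul_of_nonneg_left (Real.exp_le_exp.2 (neg_le_neg ?_)) (by norm_num)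
      have a1 := mul_le_mul_of_nonneg_left
        (mul_min_sq_div_le hP0.le h2l (by norm_num : (1 : ℝ) ≤ 16)) hm'.le
      have a2 := mul_le_mul_of_nonneg_left hE1 hz0.le
      have a3 : 0 ≤ z * E := by positivity
      linarith
    have e2 : 6 * Real.exp (-(min (r ^ 2 * min ((Q * z / 8) ^ 2) (Q * z / 8))
        (m * k * (Q * z / 8) ^ 2 / ρ) / 1152)) ≤ 6 * Real.exp (-(z * (E / 131072))) := by
      refine mul_le_mul_of_nonneg_left (Real.exp_le_exp.2 (neg_le_neg ?_)) (by norm_num)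
      have a3 : 0 ≤ z * E := by positivity
      have a4 : z * E / 64 ≤ min (r ^ 2 * min ((Q * z / 8) ^ 2) (Q * z / 8))
          (m * k * (Q * z / 8) ^ 2 / ρ) := by
        refine le_min ?_ ?_
        · have a1 := mul_le_mul_of_nonneg_left
            (mul_min_sq_div_le hQ0.le h2l (by norm_num : (1 : ℝ) ≤ 8)) (sq_nonneg r)
          have a2 := mul_le_mul_of_nonneg_left hE2 hz0.le
          linarith
        · have a1 : m * k * (Q * z / 8) ^ 2 / ρ = z ^ 2 * (m * k * Q ^ 2 / ρ) / 64 := by ring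
          rw [a1]
          have a2 := mul_le_mul_of_nonneg_left hE3 (sq_nonneg z)
          have a5 : z * E ≤ z ^ 2 * E := mul_le_mul_of_nonneg_right (by nlinarith) hE0
          linarith
      linarith
    refine (measureReal_mono (s₂ := {ω | θ / z ≤ |dev ω.1 ω.2.1 x.1 x.2|} ∪
      {ω | ω ∈ goodEvent N r ∧ θ / z ≤ |dev ω.1 ω.2.1 x.1 (noise N ω.2.2)|}) ?_).trans
      ((measureReal_union_le _ _).trans (by linarith))
    rintro ω ⟨hg, hω⟩
    rw [not_and_or, not_le, not_le] at hω
    exact hω.imp (fun h => h.le) (fun h => ⟨hg, h.le⟩)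
  have hcov : {ω : Randomness m k n | ω ∈ goodEvent N r ∧ ∃ x ∈ U,
      ¬ (|dev ω.1 ω.2.1 x.1 x.2| ≤ θ / z ∧ |dev ω.1 ω.2.1 x.1 (noise N ω.2.2)| ≤ θ / z)}
      ⊆ ⋃ x ∈ U, {ω | ω ∈ goodEvent N r ∧
      ¬ (|dev ω.1 ω.2.1 x.1 x.2| ≤ θ / z ∧ |dev ω.1 ω.2.1 x.1 (noise N ω.2.2)| ≤ θ / z)} := by
    rintro ω ⟨hg, x, hxU, hω⟩
    exact Set.mem_biUnion hxU ⟨hg, hω⟩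
  refine (measureReal_mono hcov (measure_ne_top _ _)).trans ((measureReal_biUnion_finset_le _ _).trans
    ((Finset.sum_le_sum hx).trans ?_))
  rw [Finset.sum_const, nsmul_eq_mul]
  exact mul_le_mul_of_nonneg_right hcard (by positivity)

/-- The growth of the nets along the chain is beaten by the growth of the rates. -/
lemma chain_level_bound_le {d : ℕ} {D c : ℝ} (hD : 0 ≤ D) (hc : 3 * (d : ℝ) + 1 ≤ c) (l : ℕ) :
    (D * 4 ^ l) ^ (2 * d) * (12 * Real.exp (-(2 ^ l * c)))
      ≤ 12 * D ^ (2 * d) * Real.exp (-c) * (1 / 2) ^ l := by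
  have hd : (0 : ℝ) ≤ d := Nat.cast_nonneg d
  have hl : (0 : ℝ) ≤ l := Nat.cast_nonneg l
  have hc0 : 0 ≤ c := by linarith
  have h2l : (l : ℝ) + 1 ≤ 2 ^ l := by
    exact_mod_cast Nat.lt_two_pow_self (n := l)
  have h16 : (16 : ℝ) ≤ Real.exp 3 := by
    have h1 := Real.exp_one_gt_d9
    have h3 : Real.exp 3 = Real.exp 1 ^ 3 := by rw [← Real.exp_nat_mul]; norm_num
    have h2 : (2.6 : ℝ) ^ 3 ≤ Real.exp 1 ^ 3 := pow_le_pow_left₀ (by norm_num) (by linarith) 3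
    rw [h3]
    refine le_trans (by norm_num) h2
  have h4 : ((4 : ℝ) ^ l) ^ (2 * d) ≤ Real.exp (3 * d * l) := by
    have : ((4 : ℝ) ^ l) ^ (2 * d) = 16 ^ (d * l) := by
      rw [← pow_mul, show l * (2 * d) = 2 * (d * l) by ring, pow_mul]; norm_num
    rw [this]
    refine (pow_le_pow_left₀ (by norm_num) h16 _).trans (le_of_eq ?_)
    rw [← Real.exp_nat_mul]
    congr 1
    push_cast
    ring
  have hhalf : Real.exp (-(l : ℝ)) ≤ (1 / 2) ^ l := by
    have h1 : Real.exp (-1) ≤ 1 / 2 := by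
      rw [Real.exp_neg, one_div]
      exact inv_anti₀ (by norm_num) (by linarith [Real.exp_one_gt_d9])
    have := pow_le_pow_left₀ (Real.exp_pos _).le h1 l
    rwa [← Real.exp_nat_mul, mul_neg_one] at this
  have hexp : Real.exp (3 * d * l) * Real.exp (-(2 ^ l * c)) ≤ Real.exp (-c) * Real.exp (-(l : ℝ)) := by
    rw [← Real.exp_add, ← Real.exp_add]
    apply Real.exp_le_exp.2
    have h1 := mul_le_mul_of_nonneg_right h2l hc0
    have h2 := mul_le_mul_of_nonneg_left hc hl
    linarith
  calc (D * 4 ^ l) ^ (2 * d) * (12 * Real.exp (-(2 ^ l * c)))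
      = 12 * D ^ (2 * d) * (((4 : ℝ) ^ l) ^ (2 * d) * Real.exp (-(2 ^ l * c))) := by
        rw [mul_pow]; ring
    _ ≤ 12 * D ^ (2 * d) * (Real.exp (-c) * (1 / 2) ^ l) := by
        refine mul_le_mul_of_nonneg_left ?_ (by positivity)
        refine (mul_le_mul_of_nonneg_right h4 (Real.exp_pos _).le).trans (hexp.trans ?_)
        exact mul_le_mul_of_nonneg_left hhalf (Real.exp_pos _).le
    _ = _ := by ring

/-- Union bound over all levels of the chain. -/
lemma law_chain_le {m k n d : ℕ} (hm : 0 < m) (hk : 0 < k) (h : m * k ≤ n)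
    {N : Finset (Fin n)} (hN : N.Nonempty) {r : ℝ} (hr : 1 ≤ r) (hrm : r ^ 4 = m) {σ θ D : ℝ}
    (hσ : 0 < σ) (hθ : 0 < θ) (hD : 0 ≤ D) (U : ℕ → Finset ((Fin n → ℝ) × (Fin n → ℝ)))
    (hcard : ∀ l, ((U l).card : ℝ) ≤ (D * 4 ^ l) ^ (2 * d))
    (hU : ∀ l, ∀ x ∈ U l, (∀ i, |x.1 i| ≤ 8 * σ / 4 ^ l) ∧ ∀ i, |x.2 i| ≤ 2 * σ)
    (hrate : 3 * (d : ℝ) + 1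
      ≤ chainRate m k r ((N.card : ℝ) / n) (θ / σ ^ 2) (θ / σ) / 131072) :
    (law m k n).real {ω | ω ∈ goodEvent N r ∧ ¬ ∀ l, ∀ x ∈ U l,
        |dev ω.1 ω.2.1 x.1 x.2| ≤ θ / 2 ^ l ∧ |dev ω.1 ω.2.1 x.1 (noise N ω.2.2)| ≤ θ / 2 ^ l}
      ≤ 24 * D ^ (2 * d) * Real.exp
          (-(chainRate m k r ((N.card : ℝ) / n) (θ / σ ^ 2) (θ / σ) / 131072)) := by
  have := isProbabilityMeasure_law h
  set c := chainRate m k r ((N.card : ℝ) / n) (θ / σ ^ 2) (θ / σ) / 131072 with hc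
  have hlev := fun l => (law_chain_level_le hm hk h hN hr hrm hσ hθ l (U l) (hcard l) (hU l)).trans
    (chain_level_bound_le hD hrate l)
  have hcov : {ω : Randomness m k n | ω ∈ goodEvent N r ∧ ¬ ∀ l, ∀ x ∈ U l,
        |dev ω.1 ω.2.1 x.1 x.2| ≤ θ / 2 ^ l ∧ |dev ω.1 ω.2.1 x.1 (noise N ω.2.2)| ≤ θ / 2 ^ l}
      ⊆ ⋃ l, {ω | ω ∈ goodEvent N r ∧ ∃ x ∈ U l, ¬ (|dev ω.1 ω.2.1 x.1 x.2| ≤ θ / 2 ^ l ∧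
        |dev ω.1 ω.2.1 x.1 (noise N ω.2.2)| ≤ θ / 2 ^ l)} := by
    rintro ω ⟨hg, hω⟩
    push Not at hω
    obtain ⟨l, x, hx, hω⟩ := hω
    exact Set.mem_iUnion.2 ⟨l, hg, x, hx, fun hcon => absurd (hω hcon.1) (not_lt.2 hcon.2)⟩
  refine ENNReal.toReal_le_of_le_ofReal (by positivity) ((measure_mono hcov).trans
    ((measure_iUnion_le _).trans ?_))
  calc _ ≤ ∑' l : ℕ, ENNReal.ofReal (12 * D ^ (2 * d) * Real.exp (-c) * (1 / 2) ^ l) := by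
        refine ENNReal.tsum_le_tsum fun l => ?_
        rw [← ofReal_measureReal (measure_ne_top _ _)]
        exact ENNReal.ofReal_le_ofReal (hlev l)
    _ = ENNReal.ofReal (∑' l : ℕ, 12 * D ^ (2 * d) * Real.exp (-c) * (1 / 2) ^ l) :=
        (ENNReal.ofReal_tsum_of_nonneg (fun l => by positivity)
          (summable_geometric_two.mul_left _)).symm
    _ ≤ _ := by
        rw [tsum_mul_left, tsum_geometric_two]
        exact ENNReal.ofReal_le_ofReal (le_of_eq (by ring))

/-! ### Uniform deviation over the model class -/

/-- The residuals of a model on the noiseless dataset. -/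
def residual {n d d' : ℕ} (D : Dataset n d) (F : ModelClass d d') (s : EuclideanSpace ℝ (Fin d'))
    (i : Fin n) : ℝ :=
  D.y i - F.eval s (D.x i)

/-- The losses are quadratic in the noisy residuals, which are the residuals plus the noise. -/
lemma output_val_sub_intermediate_val {n d d' m k : ℕ} (D : Dataset n d) (N : Finset (Fin n))
    (F : ModelClass d d') (s : EuclideanSpace ℝ (Fin d')) (ω : Randomness m k n) :
    1 / ((m : ℝ) * (k : ℝ)) * (output D N ω).val (F.eval s)
        - 1 / (n : ℝ) * (intermediate D N ω).val (F.eval s)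
      = dev ω.1 ω.2.1 (residual D F s) (residual D F s)
        + 2 * dev ω.1 ω.2.1 (residual D F s) (noise N ω.2.2)
        + dev ω.1 ω.2.1 (noise N ω.2.2) (noise N ω.2.2) := by
  have hres : ∀ i, (intermediate D N ω).y i - F.eval s (D.x i)
      = (residual D F s + noise N ω.2.2) i := by
    intro i
    simp only [intermediate, residual, noise, Pi.add_apply]
    split_ifs <;> ring
  have h1 : (intermediate D N ω).val (F.eval s)
      = ∑ i, (residual D F s + noise N ω.2.2) i * (residual D F s + noise N ω.2.2) i := by
    refine Finset.sum_congr rfl fun i _ => ?_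
    rw [← hres i, sq]
    rfl
  have h2 : (output D N ω).val (F.eval s)
      = ∑ j, (∑ r, ω.2.1 (j, r) * (residual D F s + noise N ω.2.2) (ω.1 (j, r)))
        * (∑ r, ω.2.1 (j, r) * (residual D F s + noise N ω.2.2) (ω.1 (j, r))) := by
    refine Finset.sum_congr rfl fun j _ => ?_
    change (∑ r, ω.2.1 (j, r) * (intermediate D N ω).y (ω.1 (j, r))
      - ∑ r, ω.2.1 (j, r) * F.eval s (D.x (ω.1 (j, r)))) ^ 2 = _
    rw [← sq, ← Finset.sum_sub_distrib]
    congr 1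
    refine Finset.sum_congr rfl fun r _ => ?_
    rw [← hres, mul_sub]
  rw [h1, h2]
  change dev ω.1 ω.2.1 (residual D F s + noise N ω.2.2) (residual D F s + noise N ω.2.2) = _
  rw [dev_add_left, dev_add_right, dev_add_right, dev_comm _ _ (noise N ω.2.2) (residual D F s)]
  ring

/-- Uniform deviation over the model class, before the rates are compared: the exceptional events
are noise that is too heavy, a large deviation of the noise itself, and a failure on the chain. -/
lemma law_uniform_deviation_le {n d d' m k : ℕ} (hm : 0 < m) (hk : 0 < k) (h : m * k ≤ n)
    (D : Dataset n d) {N : Finset (Fin n)} (hN : N.Nonempty) (F : ModelClass d d')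
    {L B₂ B₄ σ θ r : ℝ} (hL : 0 ≤ L) (hB₄ : 0 ≤ B₄) (hσ : 0 < σ) (hθ : 0 < θ)
    (hx : ∀ i, ‖D.x i‖ ≤ B₂) (hF : F.IsBoundedLipschitz L B₂ B₄)
    (hloss : ∀ s ∈ F.params, ∀ i, |D.y i - F.eval s (D.x i)| ≤ σ)
    (hr : 1 ≤ r) (hrm : r ^ 4 = m)
    (hrate : 3 * (d' : ℝ) + 1
      ≤ chainRate m k r ((N.card : ℝ) / n) (θ / 16 / σ ^ 2) (θ / 16 / σ) / 131072) :
    (law m k n).real {ω | ¬ ∀ s ∈ F.params,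
        |1 / ((m : ℝ) * (k : ℝ)) * (output D N ω).val (F.eval s)
          - 1 / (n : ℝ) * (intermediate D N ω).val (F.eval s)| ≤ θ}
      ≤ (2 * r ^ 4 * Real.exp (-(r / 2)) + Real.exp (-(r / 8)))
        + 10 * Real.exp (-(min (r ^ 2 * (θ / 2) ^ 2) r / 8192))
        + 24 * (1 + 2 * (L * B₄) / σ) ^ (2 * d') * Real.exp
          (-(chainRate m k r ((N.card : ℝ) / n) (θ / 16 / σ ^ 2) (θ / 16 / σ) / 131072)) := by
  have := isProbabilityMeasure_law h
  obtain ⟨U, hcard, hU, hchain⟩ := exists_chain F.params (residual D F) hL hB₄ hσ hF.1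
    (fun s hs t ht i => by
      have := hF.2 s hs t ht (D.x i) (hx i)
      rw [residual, residual, sub_sub_sub_cancel_left, abs_sub_comm]
      exact this) hloss
  have h1 := law_goodEvent_compl_le hm hk h N hr hrm
  have h2 := law_dev_noise_noise_ge_le hm hk h N hr hrm (x := θ / 2) (by positivity)
  have h3 := law_chain_le hm hk h hN hr hrm hσ (θ := θ / 16) (by positivity) (by positivity) U hcard
    hU hrate
  have hcov : {ω : Randomness m k n | ¬ ∀ s ∈ F.params,
        |1 / ((m : ℝ) * (k : ℝ)) * (output D N ω).val (F.eval s)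
          - 1 / (n : ℝ) * (intermediate D N ω).val (F.eval s)| ≤ θ}
      ⊆ ((goodEvent N r)ᶜ ∪ {ω | ω ∈ goodEvent N r ∧
          θ / 2 ≤ |dev ω.1 ω.2.1 (noise N ω.2.2) (noise N ω.2.2)|})
        ∪ {ω | ω ∈ goodEvent N r ∧ ¬ ∀ l, ∀ x ∈ U l, |dev ω.1 ω.2.1 x.1 x.2| ≤ θ / 16 / 2 ^ l ∧
          |dev ω.1 ω.2.1 x.1 (noise N ω.2.2)| ≤ θ / 16 / 2 ^ l} := by
    intro ω hω
    by_contra hcon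
    rw [Set.mem_union, Set.mem_union, not_or, not_or, Set.mem_compl_iff, not_not] at hcon
    obtain ⟨⟨hg, hnn⟩, hch⟩ := hcon
    refine hω fun s hs => ?_
    rw [output_val_sub_intermediate_val]
    have hch' := not_not.1 fun hno => hch ⟨hg, hno⟩
    have hnn' := not_le.1 fun hno => hnn ⟨hg, hno⟩
    have := hchain ω.1 ω.2.1 (noise N ω.2.2) (θ / 16) hch' s hs
    refine (abs_add_le _ _).trans ?_
    linarith
  exact (measureReal_mono hcov (measure_ne_top _ _)).trans ((measureReal_union_le _ _).trans
    (add_le_add ((measureReal_union_le _ _).trans (add_le_add h1 h2)) h3))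

/-! ### Comparison of the rates -/

/-- If the net size at the coarsest scale is not controlled by the argument of the logarithm in the
final bound, then `θ` is so large in comparison with the residuals that the excess is small. -/
lemma log_excess_le {r σ θ : ℝ} (hr : 1 ≤ r) (hσ : 0 < σ) (hθ : 0 < θ) (hrθ : 1 ≤ r * θ)
    (hR : 1 < θ / (r ^ 4 * σ ^ 3)) :
    1 ≤ θ / σ ∧ 1 ≤ θ / σ ^ 2 ∧ Real.log (θ / (r ^ 4 * σ ^ 3)) ≤ 3 * (θ / σ) ∧
      Real.log (θ / (r ^ 4 * σ ^ 3)) ≤ 3 * (θ / σ ^ 2) := by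
  have hr0 : 0 < r := by linarith
  set R := θ / (r ^ 4 * σ ^ 3) with hRdef
  have hR0 : 0 < R := by linarith
  have hr4 : 1 ≤ r ^ 4 := one_le_pow₀ hr
  have hθR : θ = R * r ^ 4 * σ ^ 3 := by rw [hRdef]; field_simp
  have hlogR : Real.log R ≤ R := (Real.log_le_sub_one_of_pos hR0).trans (by linarith)
  set p := θ / σ ^ 2 with hp
  set q := θ / σ with hq
  have hp0 : 0 < p := by positivity
  have hq0 : 0 < q := by positivity
  have hqp : q = p * σ := by rw [hp, hq]; field_simp
  rcases le_total 1 σ with h1 | h1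
  · have hpR : R ≤ p := by
      have : p = R * (r ^ 4 * σ) := by rw [hp, hθR]; field_simp
      rw [this]
      exact le_mul_of_one_le_right hR0.le (one_le_mul_of_one_le_of_one_le hr4 h1)
    have hpq : p ≤ q := by rw [hqp]; exact le_mul_of_one_le_right hp0.le h1
    exact ⟨by linarith, by linarith, by linarith, by linarith⟩
  · have hqp' : q ≤ p := by rw [hqp]; exact mul_le_of_le_one_right hp0.le h1
    have hRq : R ≤ q ^ 3 := by
      have e1 : R = q / (r ^ 4 * σ ^ 2) := by rw [hRdef, hq]; field_simp
      have e2 : 1 ≤ (r * θ) ^ 2 := one_le_pow₀ hrθ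
      have e3 : (r * θ) ^ 2 = q ^ 2 * (r ^ 2 * σ ^ 2) := by rw [hq]; field_simp
      have e4 : r ^ 2 * σ ^ 2 ≤ r ^ 4 * σ ^ 2 :=
        mul_le_mul_of_nonneg_right (pow_le_pow_right₀ hr (by norm_num)) (sq_nonneg σ)
      rw [e1, div_le_iff₀ (by positivity)]
      have e5 : 1 ≤ q ^ 2 * (r ^ 4 * σ ^ 2) := by
        rw [e3] at e2
        exact e2.trans (mul_le_mul_of_nonneg_left e4 (sq_nonneg q))
      calc q ≤ q * (q ^ 2 * (r ^ 4 * σ ^ 2)) := le_mul_of_one_le_right hq0.le e5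
        _ = _ := by ring
    have hq1 : 1 ≤ q := by
      by_contra! hcon
      have := pow_le_one₀ hq0.le hcon.le (n := 3)
      linarith
    have hlog : Real.log R ≤ 3 * q := by
      have e1 := Real.log_le_log hR0 hRq
      rw [Real.log_pow] at e1
      have e2 := Real.log_le_sub_one_of_pos hq0
      push_cast at e1
      linarith
    exact ⟨hq1, by linarith, hlog, by linarith⟩

/-- The chaining rate dominates each rate in the final bound. -/
lemma le_chainRate {m k : ℕ} (hk : 0 < k) {r ρ σ θ M : ℝ} (hr : 1 ≤ r)
    (hrm : r ^ 4 = m) (hσ : 0 < σ) (hθ : 0 < θ)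
    (h1 : M ≤ m * θ ^ 2 / (σ ^ 2) ^ 2) (h2 : M ≤ m * k * θ ^ 2 / (ρ * σ ^ 2)) (h3 : M ≤ r)
    (h4 : M ≤ θ ^ 2 * r ^ 2 / ((k : ℝ) ^ 2 + k * σ ^ 2)) :
    M / 256 ≤ chainRate m k r ρ (θ / 16 / σ ^ 2) (θ / 16 / σ) := by
  have hk' : (1 : ℝ) ≤ k := by exact_mod_cast hk
  have hr0 : 0 < r := by linarith
  have hr2 : r ≤ r ^ 2 := by nlinarith
  have hr4 : r ^ 2 ≤ r ^ 4 := pow_le_pow_right₀ hr (by norm_num)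
  -- a lower bound for the square gives one for the minimum with the linear rate
  have hlin : ∀ {K y : ℝ}, r ≤ K → 0 ≤ y → M / 256 ≤ K * y ^ 2 → M / 256 ≤ K * min (y ^ 2) y := by
    intro K y hK hy hM
    rw [mul_min_of_nonneg _ _ (by linarith)]
    refine le_min hM ?_
    rcases le_total y 1 with hy1 | hy1
    · exact hM.trans (mul_le_mul_of_nonneg_left (by nlinarith) (by linarith))
    · have : K ≤ K * y := le_mul_of_one_le_right (by linarith) hy1
      rcases le_total 0 M with hM0 | hM0 <;> linarith
  refine le_min (hlin (by linarith) (by positivity) ?_) (le_min (hlin hr2 (by positivity) ?_) ?_)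
  · refine le_trans (div_le_div_of_nonneg_right h1 (by norm_num)) (le_of_eq ?_)
    field_simp
    norm_num
  · have h5 : θ ^ 2 * r ^ 2 / ((k : ℝ) ^ 2 + k * σ ^ 2) ≤ θ ^ 2 * r ^ 2 / σ ^ 2 := by
      refine div_le_div_of_nonneg_left (by positivity) (by positivity) ?_
      nlinarith [sq_nonneg σ, sq_nonneg (k : ℝ)]
    refine le_trans (div_le_div_of_nonneg_right (h4.trans h5) (by norm_num)) (le_of_eq ?_)
    field_simp
    norm_num
  · refine le_trans (div_le_div_of_nonneg_right h2 (by norm_num)) (le_of_eq ?_)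
    rw [div_div, div_pow, div_pow]
    field_simp
    norm_num

/-- The chaining rate exceeds a multiple of `r ^ 2 y` for every `y` below `θ / σ` and `θ / σ ^ 2`, if
both are at least `1`: then the linear terms in the rate dominate. -/
lemma min_le_chainRate {m k : ℕ} (hk : 0 < k) {r ρ σ θ y : ℝ} (hr : 1 ≤ r) (hrm : r ^ 4 = m)
    (hρ0 : 0 < ρ) (hρ1 : ρ ≤ 1) (hq : 1 ≤ θ / σ) (hp : 1 ≤ θ / σ ^ 2) (hyq : y ≤ θ / σ)
    (hyp : y ≤ θ / σ ^ 2) :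
    r ^ 2 * y / 256 ≤ chainRate m k r ρ (θ / 16 / σ ^ 2) (θ / 16 / σ) := by
  have hk' : (1 : ℝ) ≤ k := by exact_mod_cast hk
  have hr0 : 0 < r := by linarith
  have hr4 : r ^ 2 ≤ r ^ 4 := pow_le_pow_right₀ hr (by norm_num)
  have e1 : θ / 16 / σ ^ 2 = θ / σ ^ 2 / 16 := by ring
  have e2 : θ / 16 / σ = θ / σ / 16 := by ring
  rw [e1, e2]
  set p := θ / σ ^ 2
  set q := θ / σ
  have hmin : ∀ {z : ℝ}, 1 ≤ z → y ≤ z → r ^ 2 * y / 256 ≤ r ^ 2 * min ((z / 16) ^ 2) (z / 16) := by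
    intro z hz hyz
    have : y / 256 ≤ min ((z / 16) ^ 2) (z / 16) := le_min (by nlinarith) (by linarith)
    have := mul_le_mul_of_nonneg_left this (sq_nonneg r)
    linarith
  refine le_min ((hmin hp hyp).trans ?_) (le_min (hmin hq hyq) ?_)
  · rw [← hrm]
    exact mul_le_mul_of_nonneg_right hr4 (le_min (by positivity) (by linarith))
  · refine (hmin hq hyq).trans ?_
    rw [le_div_iff₀ hρ0, ← hrm]
    have h1 : r ^ 2 * min ((q / 16) ^ 2) (q / 16) ≤ r ^ 4 * (q / 16) ^ 2 :=
      mul_le_mul hr4 (min_le_left _ _) (le_min (by positivity) (by linarith)) (by positivity)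
    have h2 : r ^ 2 * min ((q / 16) ^ 2) (q / 16) * ρ ≤ r ^ 2 * min ((q / 16) ^ 2) (q / 16) :=
      mul_le_of_le_one_right (mul_nonneg (sq_nonneg r) (le_min (by positivity) (by linarith))) hρ1
    have h3 : r ^ 4 * (q / 16) ^ 2 ≤ r ^ 4 * k * (q / 16) ^ 2 :=
      mul_le_mul_of_nonneg_right (le_mul_of_one_le_right (by positivity) hk') (sq_nonneg _)
    linarith

/-- The terms of the exceptional probability that do not depend on the model class. -/
lemma noise_terms_le {r θ M : ℝ} (hr : 1 ≤ r) (h3 : 134217728 * M ≤ r)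
    (h4 : 134217728 * M ≤ r ^ 2 * θ ^ 2) (hM : 0 ≤ M) :
    (2 * r ^ 4 * Real.exp (-(r / 2)) + Real.exp (-(r / 8)))
        + 10 * Real.exp (-(min (r ^ 2 * (θ / 2) ^ 2) r / 8192)) ≤ 12299 * Real.exp (-M) := by
  have hr0 : 0 ≤ r / 4 := by linarith
  have h1 : r ^ 4 ≤ 6144 * Real.exp (r / 4) := by
    have := Real.pow_div_factorial_le_exp (r / 4) hr0 4
    norm_num [Nat.factorial] at this
    linarith
  have h2 : 2 * r ^ 4 * Real.exp (-(r / 2)) ≤ 12288 * Real.exp (-M) := by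
    have e1 : Real.exp (r / 4) * Real.exp (-(r / 2)) ≤ Real.exp (-M) := by
      rw [← Real.exp_add]
      exact Real.exp_le_exp.2 (by linarith)
    have e2 := mul_le_mul_of_nonneg_right h1 (Real.exp_pos (-(r / 2))).le
    linarith
  have h5 : Real.exp (-(r / 8)) ≤ Real.exp (-M) := Real.exp_le_exp.2 (by linarith)
  have h6 : Real.exp (-(min (r ^ 2 * (θ / 2) ^ 2) r / 8192)) ≤ Real.exp (-M) := by
    refine Real.exp_le_exp.2 (neg_le_neg ?_)
    have : 8192 * M ≤ min (r ^ 2 * (θ / 2) ^ 2) r := le_min (by linarith) (by linarith)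
    linarith
  linarith

/-- The logarithm of the size of the coarsest net is at most a multiple of the dimension term of the
final bound, up to a part that the chaining rate absorbs. -/
lemma log_net_le {Y σ θ r T : ℝ} (hY : 0 ≤ Y) (hσ : 0 < σ) (hθ : 0 < θ) (hr : 1 ≤ r)
    (hT1 : 1 ≤ T) (hT : Real.log (r ^ 4 * Y * σ ^ 2 / θ) ≤ T) :
    Real.log (1 + 2 * Y / σ) ≤ 3 * T + max 0 (Real.log (θ / (r ^ 4 * σ ^ 3))) := by
  have hr0 : 0 < r := by linarith
  have hD : 0 < 1 + 2 * Y / σ := by positivity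
  have hlog3 : Real.log 3 ≤ 2 := (Real.log_le_sub_one_of_pos (by norm_num)).trans (by norm_num)
  rcases le_total Y σ with h | h
  · have h1 : 1 + 2 * Y / σ ≤ 3 := by
      have : 2 * Y / σ ≤ 2 := by rw [div_le_iff₀ hσ]; linarith
      linarith
    have := Real.log_le_log hD h1
    linarith [le_max_left 0 (Real.log (θ / (r ^ 4 * σ ^ 3)))]
  · have hY0 : 0 < Y := by linarith
    have h1 : 1 + 2 * Y / σ ≤ 3 * ((r ^ 4 * Y * σ ^ 2 / θ) * (θ / (r ^ 4 * σ ^ 3))) := by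
      have e1 : (r ^ 4 * Y * σ ^ 2 / θ) * (θ / (r ^ 4 * σ ^ 3)) = Y / σ := by field_simp
      rw [e1]
      have e2 : 1 ≤ Y / σ := by rwa [one_le_div hσ]
      have e3 : 2 * Y / σ = 2 * (Y / σ) := by ring
      linarith
    have h2 := Real.log_le_log hD h1
    rw [Real.log_mul (by norm_num) (by positivity), Real.log_mul (by positivity) (by positivity)] at h2
    linarith [le_max_right 0 (Real.log (θ / (r ^ 4 * σ ^ 3)))]

/-- The term of the exceptional probability that comes from the chain. -/
lemma chain_term_le {d' : ℕ} (hd : 0 < d') {Y σ θ r T E M : ℝ} (hY : 0 ≤ Y) (hσ : 0 < σ)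
    (hθ : 0 < θ) (hr : 1 ≤ r) (hrθ : 1 ≤ r * θ) (hT1 : 1 ≤ T)
    (hT : Real.log (r ^ 4 * Y * σ ^ 2 / θ) ≤ T) (hM : 134217728 * M ≤ 256 * E)
    (hE : ∀ y : ℝ, 1 ≤ θ / σ → 1 ≤ θ / σ ^ 2 → y ≤ θ / σ → y ≤ θ / σ ^ 2 → r ^ 2 * y / 256 ≤ E)
    (hMd : 16 * (d' * T) < M) (hMr : 134217728 * M ≤ r) :
    24 * (1 + 2 * Y / σ) ^ (2 * d') * Real.exp (-(E / 131072))
      ≤ 24 * Real.exp (-M + 6 * (d' * T)) := by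
  have hd1 : (1 : ℝ) ≤ d' := by exact_mod_cast hd
  have hdT : (d' : ℝ) ≤ d' * T := le_mul_of_one_le_right (by linarith) hT1
  have hr0 : 0 < r := by linarith
  have hD : 0 < 1 + 2 * Y / σ := by positivity
  set ℓ := Real.log (θ / (r ^ 4 * σ ^ 3)) with hℓ
  have hnet := log_net_le hY hσ hθ hr hT1 hT
  -- `d'` is much smaller than `r`, and `r ℓ` is much smaller than `E`
  have habs : 2 * (d' : ℝ) * max 0 ℓ ≤ E / 262144 := by
    rcases le_total ℓ 0 with h0 | h0
    · rw [max_eq_left h0]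
      nlinarith
    · rw [max_eq_right h0]
      rcases h0.eq_or_lt with h0 | h0
      · rw [← h0]
        nlinarith
      · have hR : 1 < θ / (r ^ 4 * σ ^ 3) := (Real.log_pos_iff (by positivity)).1 h0
        obtain ⟨hq, hp, hlq, hlp⟩ := log_excess_le hr hσ hθ hrθ hR
        have h1 := hE (ℓ / 3) hq hp (by linarith) (by linarith)
        have h2 : (d' : ℝ) * 2147483648 ≤ r := by linarith
        have h3 : (d' : ℝ) * 2147483648 ≤ r ^ 2 := h2.trans (by nlinarith)
        have h4 := mul_le_mul_of_nonneg_right h3 h0.le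
        linarith
  have hpow : (1 + 2 * Y / σ) ^ (2 * d') = Real.exp (2 * d' * Real.log (1 + 2 * Y / σ)) := by
    rw [← Real.exp_log (pow_pos hD (2 * d')), Real.log_pow]
    push_cast
    rfl
  rw [hpow, mul_assoc, ← Real.exp_add]
  refine mul_le_mul_of_nonneg_left (Real.exp_le_exp.2 ?_) (by norm_num)
  have h5 := mul_le_mul_of_nonneg_left hnet (by positivity : 0 ≤ 2 * (d' : ℝ))
  nlinarith

/-! ### Minimizers and the final bound -/

/-- A uniform deviation bound implies near-optimality of every minimizer of the LLP loss. -/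
lemma minimizer_of_uniform_deviation {n d d' m k : ℕ} (D : Dataset n d) (N : Finset (Fin n))
    (F : ModelClass d d') (hm : 0 < m) (hk : 0 < k) {θ : ℝ} {ω : Randomness m k n}
    (h : ∀ s ∈ F.params, |1 / ((m : ℝ) * (k : ℝ)) * (output D N ω).val (F.eval s)
      - 1 / (n : ℝ) * (intermediate D N ω).val (F.eval s)| ≤ θ)
    {s : EuclideanSpace ℝ (Fin d')} (hs : s ∈ F.params)
    (hmin : ∀ t ∈ F.params, (output D N ω).val (F.eval s) ≤ (output D N ω).val (F.eval t))
    {t : EuclideanSpace ℝ (Fin d')} (ht : t ∈ F.params) :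
    1 / (n : ℝ) * (intermediate D N ω).val (F.eval s)
      ≤ 1 / (n : ℝ) * (intermediate D N ω).val (F.eval t) + 2 * θ := by
  have h1 := abs_le.1 (h s hs)
  have h2 := abs_le.1 (h t ht)
  have h3 := mul_le_mul_of_nonneg_left (hmin t ht) (by positivity : 0 ≤ 1 / ((m : ℝ) * (k : ℝ)))
  linarith [h1.1, h2.2]

end NoisyWtdLLP

theorem mainTheorem4 :
    ∃ c₁ c₂ c₃ c₄ C₁ C₂ : ℝ, 0 < c₁ ∧ 0 < c₂ ∧ 0 < c₃ ∧ 0 < c₄ ∧ 0 < C₁ ∧ 0 < C₂ ∧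
      ∀ (n d d' m k : ℕ), 0 < m → 0 < k → m * k ≤ n → 0 < d' →
      ∀ (D : NoisyWtdLLP.Dataset n d) (N : Finset (Fin n)), N.Nonempty →
      ∀ (F : NoisyWtdLLP.ModelClass d d') (L B₂ B₄ B θ ρ : ℝ),
        0 ≤ L → 0 ≤ B₄ → 0 < B → 0 < θ →
        ρ = (N.card : ℝ) / (n : ℝ) →
        (∀ i, ‖D.x i‖ ≤ B₂) →
        F.IsBoundedLipschitz L B₂ B₄ →
        (∀ s ∈ F.params, ∀ i, (D.y i - F.eval s (D.x i)) ^ 2 ≤ B) →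
        (NoisyWtdLLP.law m k n).real
          {ω | ¬ ((∀ s ∈ F.params,
                |1 / ((m : ℝ) * (k : ℝ)) * (NoisyWtdLLP.output D N ω).val (F.eval s)
                  - 1 / (n : ℝ) * (NoisyWtdLLP.intermediate D N ω).val (F.eval s)| ≤ θ) ∧
              (∀ s ∈ F.params,
                (∀ t ∈ F.params, (NoisyWtdLLP.output D N ω).val (F.eval s)
                  ≤ (NoisyWtdLLP.output D N ω).val (F.eval t)) →
                ∀ t ∈ F.params,
                  1 / (n : ℝ) * (NoisyWtdLLP.intermediate D N ω).val (F.eval s)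
                    ≤ 1 / (n : ℝ) * (NoisyWtdLLP.intermediate D N ω).val (F.eval t) + 2 * θ))}
        ≤ Real.exp
            (-(min (min (c₁ * ((m : ℝ) * θ ^ 2 / B ^ 2))
                      (c₂ * ((m : ℝ) * (k : ℝ) * θ ^ 2 / (ρ * B))))
                  (min (c₃ * (m : ℝ) ^ (1 / 4 : ℝ) - C₁ * Real.log (k : ℝ))
                      (c₄ * (θ ^ 2 * √(m : ℝ) / ((k : ℝ) ^ 2 + (k : ℝ) * B)))))
              + C₂ * ((d' : ℝ) * max 1 (Real.log ((m : ℝ) * L * B₄ * B / θ)))) := by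
  refine ⟨1 / 134217728, 1 / 134217728, 1 / 134217728, 1 / 134217728, 1, 16, by norm_num,
    by norm_num, by norm_num, by norm_num, by norm_num, by norm_num, ?_⟩
  intro n d d' m k hm hk hmk hd D N hN F L B₂ B₄ B θ ρ hL hB₄ hB hθ hρ hx hF hloss
  have := NoisyWtdLLP.isProbabilityMeasure_law hmk
  have hm1 : (1 : ℝ) ≤ m := by exact_mod_cast hm
  have hk1 : (1 : ℝ) ≤ k := by exact_mod_cast hk
  have hd1 : (1 : ℝ) ≤ d' := by exact_mod_cast hd
  set r : ℝ := (m : ℝ) ^ (1 / 4 : ℝ) with hr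
  have hr1 : 1 ≤ r := Real.one_le_rpow hm1 (by norm_num)
  have hr0 : 0 < r := by linarith
  have hrm : r ^ 4 = m := by
    rw [hr, ← Real.rpow_natCast, ← Real.rpow_mul (by linarith)]
    norm_num
  have hsqrt : √(m : ℝ) = r ^ 2 := by
    rw [← hrm, show r ^ 4 = (r ^ 2) ^ 2 by ring, Real.sqrt_sq (by positivity)]
  set σ : ℝ := √B with hσdef
  have hσ : 0 < σ := Real.sqrt_pos.2 hB
  have hσB : σ ^ 2 = B := Real.sq_sqrt hB.le
  set T : ℝ := max 1 (Real.log ((m : ℝ) * L * B₄ * B / θ)) with hTdef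
  have hT1 : 1 ≤ T := le_max_left _ _
  have hdT : 1 ≤ (d' : ℝ) * T := one_le_mul_of_one_le_of_one_le hd1 hT1
  rw [hsqrt]
  set M : ℝ := min (min (1 / 134217728 * ((m : ℝ) * θ ^ 2 / B ^ 2))
      (1 / 134217728 * ((m : ℝ) * (k : ℝ) * θ ^ 2 / (ρ * B))))
    (min (1 / 134217728 * r - 1 * Real.log (k : ℝ))
      (1 / 134217728 * (θ ^ 2 * r ^ 2 / ((k : ℝ) ^ 2 + (k : ℝ) * B)))) with hM
  -- the bound is trivial unless the minimum of the rates exceeds the dimension term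
  rcases le_or_gt M (16 * ((d' : ℝ) * T)) with htriv | hMd
  · refine measureReal_le_one.trans (Real.one_le_exp ?_)
    linarith
  have hlogk : 0 ≤ Real.log (k : ℝ) := Real.log_nonneg hk1
  have hM1 : 134217728 * M ≤ m * θ ^ 2 / (σ ^ 2) ^ 2 := by
    rw [hσB]; linarith [(min_le_left _ _).trans (min_le_left _ _) |> hM.le.trans]
  have hM2 : 134217728 * M ≤ m * k * θ ^ 2 / (ρ * σ ^ 2) := by
    rw [hσB]; linarith [(min_le_left _ _).trans (min_le_right _ _) |> hM.le.trans]
  have hM3 : 134217728 * M ≤ r := by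
    linarith [(min_le_right _ _).trans (min_le_left _ _) |> hM.le.trans]
  have hM4 : 134217728 * M ≤ θ ^ 2 * r ^ 2 / ((k : ℝ) ^ 2 + k * σ ^ 2) := by
    rw [hσB]; linarith [(min_le_right _ _).trans (min_le_right _ _) |> hM.le.trans]
  have hM5 : 134217728 * M ≤ r ^ 2 * θ ^ 2 := by
    refine hM4.trans ?_
    rw [mul_comm (r ^ 2)]
    refine div_le_self (by positivity) ?_
    nlinarith [mul_nonneg (by linarith : (0 : ℝ) ≤ k) (sq_nonneg σ)]
  have hrθ : 1 ≤ r * θ := by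
    have h1 : 1 ≤ (r * θ) ^ 2 := by rw [mul_pow]; linarith
    exact (one_le_sq_iff₀ (by positivity)).1 h1
  have hnk : (m : ℝ) * k ≤ n := by exact_mod_cast hmk
  have hn0 : (0 : ℝ) < n := lt_of_lt_of_le (by positivity) hnk
  have hNc : (0 : ℝ) < N.card := by exact_mod_cast hN.card_pos
  have hρ0 : 0 < ρ := by rw [hρ]; positivity
  have hρ1 : ρ ≤ 1 := by
    rw [hρ, div_le_one hn0]
    exact_mod_cast (Finset.card_le_univ N).trans (by simp)
  set E := NoisyWtdLLP.chainRate m k r ρ (θ / 16 / σ ^ 2) (θ / 16 / σ) with hE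
  have hEM : 134217728 * M ≤ 256 * E := by
    linarith [NoisyWtdLLP.le_chainRate hk hr1 hrm hσ hθ hM1 hM2 hM3 hM4]
  have hdd : (d' : ℝ) ≤ d' * T := le_mul_of_one_le_right (by linarith) hT1
  have hdev := NoisyWtdLLP.law_uniform_deviation_le hm hk hmk D hN F hL hB₄ hσ hθ hx hF
    (fun s hs i => Real.abs_le_sqrt (hloss s hs i)) hr1 hrm
    (by rw [← hρ, ← hE]; linarith)
  rw [← hρ, ← hE] at hdev
  have hnoise := NoisyWtdLLP.noise_terms_le hr1 hM3 hM5 (by linarith)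
  have hchain := NoisyWtdLLP.chain_term_le hd (mul_nonneg hL hB₄) hσ hθ hr1 hrθ hT1
    (by rw [hrm, hσB, ← mul_assoc]; exact le_max_right _ _) hEM
    (fun y hq hp hyq hyp => NoisyWtdLLP.min_le_chainRate hk hr1 hrm hρ0 hρ1 hq hp hyq hyp) hMd hM3
  refine (measureReal_mono fun ω hω => ?_).trans (hdev.trans ((add_le_add hnoise hchain).trans ?_))
  · exact fun hdevω => hω ⟨hdevω, fun s hs hmin t ht =>
      NoisyWtdLLP.minimizer_of_uniform_deviation D N F hm hk hdevω hs hmin ht⟩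
  · -- the constant `12299 + 24` costs at most `10 ≤ 10 d' T` in the exponent
    have h10 : (12323 : ℝ) ≤ Real.exp 10 := by
      have h1 : Real.exp 10 = Real.exp 1 ^ 10 := by rw [← Real.exp_nat_mul]; norm_num
      have h2 : (2.7 : ℝ) ^ 10 ≤ Real.exp 1 ^ 10 :=
        pow_le_pow_left₀ (by norm_num) (by linarith [Real.exp_one_gt_d9]) 10
      rw [h1]
      exact le_trans (by norm_num) h2
    have h11 : Real.exp (-M) ≤ Real.exp (-M + 6 * (d' * T)) := Real.exp_le_exp.2 (by linarith)
    calc 12299 * Real.exp (-M) + 24 * Real.exp (-M + 6 * (d' * T))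
        ≤ Real.exp 10 * Real.exp (-M + 6 * (d' * T)) := by
          have := mul_le_mul_of_nonneg_right h10 (Real.exp_pos (-M + 6 * (d' * T))).le
          linarith
      _ ≤ _ := by
          rw [← Real.exp_add]
          exact Real.exp_le_exp.2 (by linarith)
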